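/- **Setting.** Let $G$ be a compact Lie group with Lie algebra $\mathfrak g$. Fix an $\mathrm{Ad}$-invariant scalar product on $\mathfrak g$, with norm $\|\cdot\|$, and let $d_G$ be the distance of the biinvariant Riemannian metric on $G$ that coincides with this scalar product at $1$ (with $d_G=\infty$ between points of different connected components). Let $\exp_G:\mathfrak g\to G$ be the exponential map. For a totally ordered finite set $\mathcal P$, let $\mathbb F_{\mathcal P}$ be the free group on $\mathcal P$. Every $h$ in a free group has a unique expression $h=a_1^{\alpha_1}\cdots a_\ell^{\alpha_\ell}$, with generators $a_i\neq a_{i+1}$ and exponents $\alpha_i\in\mathbb Z\setminus\{0\}$; for a generator $x$, set $S^{(1)}(x,h)=\sum_{i:\,a_i=x}|\alpha_i|$. For $x\in\mathcal P$, let $\pi^{\le x}:\mathbb F_{\mathcal P}\to\mathbb F_{\{y\in\mathcal P:\,y\le x\}}$ be the canonical projection, which sends the generators $y>x$ to $1$. For $g\in\mathbb F_{\mathcal P}$, define $|g|_2\ge 0$ by $$|g|_2^2=\sum_{x\in\mathcal P}S^{(1)}\big(x,\pi^{\le x}(g)\big)^2 .$$ **Proposition.** There exist constants $C,c>0$, depending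 only on $G$ and on the scalar product, such that the following holds. Let $\mathcal P$ be any totally ordered finite set with $\#\mathcal P\ge 4$, and let $K\ge 1$ be any real number. Let $(H_x)_{x\in\mathcal P}$ be any i.i.d. family of $\mathfrak g$-valued random variables, defined on any probability space, that are symmetric ($-H_x$ has the law of $H_x$), $\mathrm{Ad}$-invariant ($\mathrm{Ad}_a H_x$ has the law of $H_x$ for every $a\in G$) and satisfy $\|H_x\|\le K^{-1}$ almost surely. Let $\omega_K:\mathbb F_{\mathcal P}\to G$ be the random group morphism with $\omega_K(x)=\exp_G(H_x)$ for all $x\in\mathcal P$. Then, for every $g\in\mathbb F_{\mathcal P}$ with $|g|_2^2\le cK^2$, the variable $d_G(\omega_K(g),1)$ is measurable and $$\mathbb E\big[d_G(\omega_K(g),1)\big]\le C\Big(K^{-1}|g|_2+\frac{(\log\#\mathcal P)^2}{\log\log\#\mathcal P}\,K^{-2}|g|_2^2\Big).$$ -/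

import Mathlib

open MeasureTheory ProbabilityTheory
open scoped Manifold ENNReal ContDiff

noncomputable section

namespace FreeGroup

/-- Add one letter `a` (`b = true`) or `a⁻¹` (`b = false`) at the front of a list of syllables
`(a₁, α₁), (a₂, α₂), …`, merging it with the first syllable if this one has the same letter. -/
def consSyllable {Q : Type*} [DecidableEq Q] (l : Q × Bool) : List (Q × ℤ) → List (Q × ℤ)
  | [] => [(l.1, if l.2 then 1 else -1)]
  | s :: t =>
    if s.1 = l.1 then (s.1, (if l.2 then 1 else -1) + s.2) :: t
    else (l.1, if l.2 then 1 else -1) :: s :: t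

/-- The sequence of syllables `(aᵢ(g), αᵢ(g))`, `i = 1, …, ℓ(g)`, of an element `g` of a free group:
`g = ∏ aᵢ(g) ^ αᵢ(g)` with `αᵢ(g) ≠ 0` and `aᵢ(g) ≠ aᵢ₊₁(g)`. It is obtained by grouping equal
consecutive letters in the reduced word of `g`. -/
def syllables {Q : Type*} [DecidableEq Q] (g : FreeGroup Q) : List (Q × ℤ) :=
  g.toWord.foldr consSyllable []

/-- The exponents `αᵢ(g)` over the indices `i` such that `aᵢ(g) = x`. -/
def exponents {Q : Type*} [DecidableEq Q] (x : Q) (g : FreeGroup Q) : List ℤ :=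
  (g.syllables.filter (fun s => s.1 = x)).map Prod.snd

/-- `S⁽¹⁾(x, g)`: the `ℓ¹` norm of the sequence of the exponents to which `x` appears in `g`. -/
def S1 {Q : Type*} [DecidableEq Q] (x : Q) (g : FreeGroup Q) : ℝ :=
  ((g.exponents x).map (fun n : ℤ => |(n : ℝ)|)).sum

/-- The canonical projection `π^{≤ x}` from the free group on `P` onto the free group on the
letters `y ≤ x`: the letters greater than `x` are erased. -/
def projLE {P : Type*} [LinearOrder P] (x : P) : FreeGroup P →* FreeGroup (Set.Iic x) :=
  FreeGroup.lift (fun y => if h : y ≤ x then FreeGroup.of (⟨y, h⟩ : Set.Iic x) else 1)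

/-- `|g|₂`, the nonnegative number with `|g|₂² = ∑ₓ S⁽¹⁾(x, π^{≤ x}(g))²`. -/
def norm2 {P : Type*} [LinearOrder P] [Fintype P] (g : FreeGroup P) : ℝ :=
  √(∑ x : P, (S1 (⟨x, le_rfl⟩ : Set.Iic x) (projLE x g)) ^ 2)

end FreeGroup

namespace LieGroupExp

/-- The adjoint action of an element `g` of a Lie group on its Lie algebra: the derivative at `1` of
the conjugation `x ↦ g * x * g⁻¹`. -/
def Ad {E : Type*} [NormedAddCommGroup E] [NormedSpace ℝ E] {G : Type*} [TopologicalSpace G]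
    [ChartedSpace E G] [Group G] (g : G) (X : GroupLieAlgebra 𝓘(ℝ, E) G) :
    GroupLieAlgebra 𝓘(ℝ, E) G :=
  mfderiv 𝓘(ℝ, E) 𝓘(ℝ, E) (fun x : G => g * x * g⁻¹) 1 X

/-- The curve `γ : ℝ → G` starts from `1` and is an integral curve of the left-invariant vector
field associated with `X`; that is, `γ` is the one-parameter subgroup with velocity `X` at `0`. -/
def IsExpCurve {E : Type*} [NormedAddCommGroup E] [NormedSpace ℝ E] {G : Type*}
    [TopologicalSpace G] [ChartedSpace E G] [Group G] (X : GroupLieAlgebra 𝓘(ℝ, E) G)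
    (γ : ℝ → G) : Prop :=
  γ 0 = 1 ∧ IsMIntegralCurve (I := 𝓘(ℝ, E)) γ (mulInvariantVectorField X)

/-- The one-parameter subgroup with a given velocity is unique. -/
theorem IsExpCurve.unique {E : Type*} [NormedAddCommGroup E] [NormedSpace ℝ E] [FiniteDimensional ℝ E]
    {G : Type*} [TopologicalSpace G] [T2Space G] [ChartedSpace E G] [Group G]
    [LieGroup 𝓘(ℝ, E) ∞ G] {X : GroupLieAlgebra 𝓘(ℝ, E) G} {γ γ' : ℝ → G} (h : IsExpCurve X γ)
    (h' : IsExpCurve X γ') : γ = γ' := by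
  have : CompleteSpace E := FiniteDimensional.complete ℝ E
  have : LieGroup 𝓘(ℝ, E) (minSmoothness ℝ 3) G := LieGroup.of_le (n := ∞) (by rw [minSmoothness_of_isRCLikeNormedField]; exact WithTop.coe_le_coe.2 le_top)
  have : LieGroup 𝓘(ℝ, E) 1 G := LieGroup.of_le (n := ∞) (by exact_mod_cast le_top)
  have : IsManifold 𝓘(ℝ, E) 1 G := inferInstance
  have hv := (contMDiff_mulInvariantVectorField (I := 𝓘(ℝ, E)) (G := G) X).of_le (m := 1) (by simp)
  exact isMIntegralCurve_Ioo_eq_of_contMDiff_boundaryless (t₀ := 0) hv h.2 h'.2 (h.1.trans h'.1.symm)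

/-- The one-parameter subgroup with a given velocity exists. -/
theorem exists_isExpCurve {E : Type*} [NormedAddCommGroup E] [NormedSpace ℝ E] [FiniteDimensional ℝ E]
    {G : Type*} [TopologicalSpace G] [T2Space G] [ChartedSpace E G] [Group G]
    [LieGroup 𝓘(ℝ, E) ∞ G] (X : GroupLieAlgebra 𝓘(ℝ, E) G) : ∃ γ : ℝ → G, IsExpCurve X γ := by
  have : CompleteSpace E := FiniteDimensional.complete ℝ E
  have : LieGroup 𝓘(ℝ, E) (minSmoothness ℝ 3) G := LieGroup.of_le (n := ∞) (by rw [minSmoothness_of_isRCLikeNormedField]; exact WithTop.coe_le_coe.2 le_top)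
  have : LieGroup 𝓘(ℝ, E) 1 G := LieGroup.of_le (n := ∞) (by exact_mod_cast le_top)
  have : IsManifold 𝓘(ℝ, E) 1 G := inferInstance
  have hv := (contMDiff_mulInvariantVectorField (I := 𝓘(ℝ, E)) (G := G) X).of_le (m := 1) (by simp)
  obtain ⟨γ, h0, hγ⟩ := exists_isMIntegralCurveAt_of_contMDiffAt_boundaryless (t₀ := 0)
    (hv.contMDiffAt (x := (1 : G)))
  obtain ⟨ε, hε, hγ⟩ := isMIntegralCurveAt_iff'.1 hγ
  rw [Real.ball_eq_Ioo, zero_sub, zero_add] at hγ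
  refine exists_isMIntegralCurve_of_isMIntegralCurveOn hv hε (fun a => ⟨fun t => a * γ t, by simp [h0], ?_⟩) 1
  intro t ht
  have h1 := hγ t ht
  have md : ∀ (b x : G), MDifferentiableAt 𝓘(ℝ, E) 𝓘(ℝ, E) (fun y : G => b * y) x := fun b x =>
    (contMDiff_mul_left (I := 𝓘(ℝ, E)) (n := 1) (a := b)).mdifferentiableAt one_ne_zero
  have h2 := (md a (γ t)).hasMFDerivAt.comp_hasMFDerivWithinAt t h1
  convert! h2 using 1
  have h3 : mulInvariantVectorField X (a * γ t) =
     mfderiv 𝓘(ℝ, E) 𝓘(ℝ, E) (fun y : G => a * y) (γ t) (mulInvariantVectorField X (γ t)) := by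
    have D : (fun x : G ↦ (a * γ t) * x) = (fun y ↦ a * y) ∘ (fun x ↦ γ t * x) := by
      ext x; simp [mul_assoc]
    unfold mulInvariantVectorField
    have key : ∀ z : G, z = γ t → ∀ u : E,
        (show E from mfderiv 𝓘(ℝ, E) 𝓘(ℝ, E) (fun y : G => a * y) z u) =
        (show E from mfderiv 𝓘(ℝ, E) 𝓘(ℝ, E) (fun y : G => a * y) (γ t) u) := by
      rintro z rfl u; rfl
    have h4 := mfderiv_comp_apply (I := 𝓘(ℝ, E)) (I' := 𝓘(ℝ, E)) (I'' := 𝓘(ℝ, E)) (1 : G)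
      (md a (γ t * 1)) (md (γ t) 1) X
    rw [← D] at h4
    exact h4.trans (key _ (mul_one _) _)
  apply iff_of_eq
  congr 1
  refine ContinuousLinearMap.ext fun r => ?_
  change r • mulInvariantVectorField X (a * γ t) = mfderiv 𝓘(ℝ, E) 𝓘(ℝ, E) (fun y : G => a * y) (γ t) (r • mulInvariantVectorField X (γ t))
  rw [h3, map_smul]

open Classical in
/-- The exponential map of a Lie group: the value at time `1` of the (unique) one-parameter subgroup
with velocity `X` at `0`. -/
def lieExp {E : Type*} [NormedAddCommGroup E] [NormedSpace ℝ E] {G : Type*} [TopologicalSpace G]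
    [ChartedSpace E G] [Group G] (X : GroupLieAlgebra 𝓘(ℝ, E) G) : G :=
  if h : ∃ γ : ℝ → G, IsExpCurve X γ then h.choose 1 else 1

/-- A scalar product on the Lie algebra of a Lie group `G` that is invariant under the adjoint
action of `G`. -/
structure InvariantInner (E : Type*) [NormedAddCommGroup E] [NormedSpace ℝ E] (G : Type*)
    [TopologicalSpace G] [ChartedSpace E G] [Group G] where
  form : LinearMap.BilinForm ℝ (GroupLieAlgebra 𝓘(ℝ, E) G)
  symm : ∀ X Y, form X Y = form Y X
  pos : ∀ X, X ≠ 0 → 0 < form X X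
  ad_invariant : ∀ (g : G) (X Y : GroupLieAlgebra 𝓘(ℝ, E) G), form (Ad g X) (Ad g Y) = form X Y

namespace InvariantInner

variable {E : Type*} [NormedAddCommGroup E] [NormedSpace ℝ E] {G : Type*}
  [TopologicalSpace G] [ChartedSpace E G] [Group G]

/-- The norm on the Lie algebra given by the scalar product. -/
def norm (B : InvariantInner E G) (X : GroupLieAlgebra 𝓘(ℝ, E) G) : ℝ := √(B.form X X)

/-- The Riemannian norm on the tangent space at `x`: a tangent vector is brought back to the Lie
algebra by the left translation by `x⁻¹`. -/
abbrev tangentENorm (B : InvariantInner E G) (x : G) : ENorm (TangentSpace 𝓘(ℝ, E) x) where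
  enorm v := ENNReal.ofReal (B.norm (mfderiv 𝓘(ℝ, E) 𝓘(ℝ, E) (fun y : G => x⁻¹ * y) x v))

/-- The Riemannian distance `d_G` of the biinvariant Riemannian metric on `G` which coincides with
the scalar product at `1`. It is the infimum of the lengths of the `C¹` paths between two points
(hence finite on each connected component, and `∞` between different components). -/
def edist (B : InvariantInner E G) (x y : G) : ℝ≥0∞ :=
  @Manifold.riemannianEDist E _ _ E _ 𝓘(ℝ, E) G _ _ B.tangentENorm x y

end InvariantInner

end LieGroupExp

end

/-! On points at finite distance from 1, the squared distance to 1 is at most a constant times a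
smooth function `φ ≥ 0` that vanishes only at 1 (`exists_contMDiff_edist_le`). It is therefore
enough to bound the expectation of `φ` at the random word by a constant times `K⁻² |g|₂²`. Jensen's
inequality then gives an expected distance of order `K⁻¹ |g|₂`, and the logarithmic term of the
conclusion, being nonnegative, is simply added.

To bound the expectation of `φ`, the letters are revealed in increasing order. Let `w` be the word
in the letters `< x`. Moving every occurrence of `x` to the right by conjugation writes the word in
the letters `≤ x` as `w * ∏ exp Aᵢ`, where the `Aᵢ` are adjoint images of multiples of `H x`
(`exists_syllableProd_update`). Since the scalar product is invariant, conjugation costs nothing,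
and the norms of the `Aᵢ` add up to `‖H x‖` times the `S1` of `x` in the projected word.

Replacing `H x` by `-H x` flips the sign of every `Aᵢ` and, by symmetry and independence, preserves
the joint law (`identDistrib_update_neg`). In the average over the two signs the first-order terms
cancel. The rest is controlled by mixed second differences of `φ`
(`exists_abs_mixed_difference_le`), hence is quadratic in `∑ ‖Aᵢ‖`. Telescoping over `x` produces
`∑ₓ S1² = |g|₂²` (`integral_wordExp_le`). -/

noncomputable section

namespace LieGroupExp

open Set Filter Topology Bundle

/-! ### Derivatives along left-invariant vector fields. -/

section Calculus

variable {E : Type*} [NormedAddCommGroup E] [NormedSpace ℝ E]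
  {G : Type*} [TopologicalSpace G] [ChartedSpace E G] [Group G]

/-- The derivative of a function on a Lie group along a left-invariant vector field. -/
def leftDeriv (f : G → ℝ) (X : GroupLieAlgebra 𝓘(ℝ, E) G) (x : G) : ℝ :=
  mfderiv 𝓘(ℝ, E) 𝓘(ℝ, ℝ) f x (mulInvariantVectorField X x)

theorem leftDeriv_add (f : G → ℝ) (X Y : GroupLieAlgebra 𝓘(ℝ, E) G) (x : G) :
    leftDeriv f (X + Y) x = leftDeriv f X x + leftDeriv f Y x := by
  have := congrFun (mulInvariantVectorField_add X Y) x
  unfold leftDeriv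
  rw [this, Pi.add_apply]
  exact map_add (mfderiv 𝓘(ℝ, E) 𝓘(ℝ, ℝ) f x) _ _

theorem leftDeriv_smul (f : G → ℝ) (c : ℝ) (X : GroupLieAlgebra 𝓘(ℝ, E) G) (x : G) :
    leftDeriv f (c • X) x = c * leftDeriv f X x := by
  have := congrFun (mulInvariantVectorField_smul c X) x
  unfold leftDeriv
  rw [this, Pi.smul_apply]
  exact map_smul (mfderiv 𝓘(ℝ, E) 𝓘(ℝ, ℝ) f x) _ _

/-- `leftDeriv f · x` as a linear form on the Lie algebra. -/
def leftDerivₗ (f : G → ℝ) (x : G) : GroupLieAlgebra 𝓘(ℝ, E) G →ₗ[ℝ] ℝ where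
  toFun X := leftDeriv f X x
  map_add' X Y := leftDeriv_add f X Y x
  map_smul' c X := leftDeriv_smul f c X x

theorem IsExpCurve.smul {X : GroupLieAlgebra 𝓘(ℝ, E) G} {γ : ℝ → G} (h : IsExpCurve X γ) (s : ℝ) :
    IsExpCurve (s • X) (fun t => γ (t * s)) := by
  refine ⟨by simpa using h.1, ?_⟩
  rw [mulInvariantVectorField_smul]
  exact h.2.comp_mul s

theorem hasDerivAt_comp_isMIntegralCurve {X : GroupLieAlgebra 𝓘(ℝ, E) G} {γ : ℝ → G}
    (h : IsMIntegralCurve (I := 𝓘(ℝ, E)) γ (mulInvariantVectorField X)) {f : G → ℝ}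
    (hf : MDifferentiable 𝓘(ℝ, E) 𝓘(ℝ, ℝ) f) (t : ℝ) :
    HasDerivAt (fun t => f (γ t)) (leftDeriv f X (γ t)) t := by
  have h2 := (hf (γ t)).hasMFDerivAt.comp t (h t)
  have h3 : HasFDerivAt (𝕜 := ℝ) (E := ℝ) (F := ℝ) (f ∘ γ) _ t := hasMFDerivAt_iff_hasFDerivAt.1 h2
  refine h3.hasDerivAt.congr_deriv ?_
  change mfderiv 𝓘(ℝ, E) 𝓘(ℝ, ℝ) f (γ t) ((1 : ℝ) • mulInvariantVectorField X (γ t)) = _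
  rw [one_smul]
  rfl

variable [LieGroup 𝓘(ℝ, E) ∞ G]

variable (E G) in
theorem lieGroup_minSmoothness : LieGroup 𝓘(ℝ, E) (minSmoothness ℝ 3) G :=
  LieGroup.of_le (n := ∞) (by
    rw [minSmoothness_of_isRCLikeNormedField]; exact WithTop.coe_le_coe.2 le_top)

variable (E G) in
theorem isManifold_one : IsManifold 𝓘(ℝ, E) 1 G :=
  have := LieGroup.of_le (I := 𝓘(ℝ, E)) (G := G) (n := ∞) (m := 1) (by exact_mod_cast le_top)
  inferInstance

theorem contMDiff_mul_left' (a : G) : ContMDiff 𝓘(ℝ, E) 𝓘(ℝ, E) ∞ (fun y : G => a * y) :=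
  contMDiff_mul_left

theorem mdifferentiableAt_mul_left' (a x : G) :
    MDifferentiableAt 𝓘(ℝ, E) 𝓘(ℝ, E) (fun y : G => a * y) x :=
  (contMDiff_mul_left' a).mdifferentiableAt (by simp)

theorem mdifferentiableAt_mul_right' (a x : G) :
    MDifferentiableAt 𝓘(ℝ, E) 𝓘(ℝ, E) (fun y : G => y * a) x :=
  (contMDiff_mul_right (I := 𝓘(ℝ, E)) (n := ∞) (a := a)).mdifferentiableAt (by simp)

/-- The derivative is the fibre component of the tangent map of `f` composed with the section given
by `X`. The cap `m ≤ 2` is the regularity taken from that section. -/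
theorem contMDiff_leftDeriv {f : G → ℝ} {m n : ℕ∞ω} (hf : ContMDiff 𝓘(ℝ, E) 𝓘(ℝ, ℝ) n f)
    (hm : m ≤ 2) (hmn : m + 1 ≤ n) (X : GroupLieAlgebra 𝓘(ℝ, E) G) :
    ContMDiff 𝓘(ℝ, E) 𝓘(ℝ, ℝ) m (leftDeriv f X) := by
  have := lieGroup_minSmoothness E G
  have := isManifold_one E G
  have hV := (contMDiff_mulInvariantVectorField (I := 𝓘(ℝ, E)) (G := G) X).of_le (m := m)
    (by rwa [minSmoothness_of_isRCLikeNormedField])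
  have hT : ContMDiff 𝓘(ℝ, E).tangent 𝓘(ℝ, ℝ).tangent m
    (tangentMap 𝓘(ℝ, E) 𝓘(ℝ, ℝ) f) := hf.contMDiff_tangentMap hmn
  exact ((contMDiff_snd_tangentBundle_modelSpace ℝ 𝓘(ℝ, ℝ)).comp hT).comp hV

/-- Chain rule applied to `(a * x) * y = a * (x * y)`. -/
theorem mulInvariantVectorField_mul (X : GroupLieAlgebra 𝓘(ℝ, E) G) (a x : G) :
    mulInvariantVectorField X (a * x) =
      mfderiv 𝓘(ℝ, E) 𝓘(ℝ, E) (fun y : G => a * y) x (mulInvariantVectorField X x) := by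
  have D : (fun y : G ↦ (a * x) * y) = (fun y ↦ a * y) ∘ (fun y ↦ x * y) := by
    ext y; simp [mul_assoc]
  unfold mulInvariantVectorField
  -- The base points `x * 1` and `x` are only propositionally equal, so the derivatives are compared
  -- after viewing both tangent spaces as `E`.
  have key : ∀ z : G, z = x → ∀ u : E,
      (show E from mfderiv 𝓘(ℝ, E) 𝓘(ℝ, E) (fun y : G => a * y) z u) =
      (show E from mfderiv 𝓘(ℝ, E) 𝓘(ℝ, E) (fun y : G => a * y) x u) := by
    rintro z rfl u; rfl
  have h4 := mfderiv_comp_apply (I := 𝓘(ℝ, E)) (I' := 𝓘(ℝ, E)) (I'' := 𝓘(ℝ, E)) (1 : G)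
    (mdifferentiableAt_mul_left' a (x * 1)) (mdifferentiableAt_mul_left' x 1) X
  rw [← D] at h4
  exact h4.trans (key _ (mul_one _) _)

theorem isMIntegralCurve_mul_left {X : GroupLieAlgebra 𝓘(ℝ, E) G} {γ : ℝ → G}
    (h : IsMIntegralCurve (I := 𝓘(ℝ, E)) γ (mulInvariantVectorField X)) (a : G) :
    IsMIntegralCurve (I := 𝓘(ℝ, E)) (fun t => a * γ t) (mulInvariantVectorField X) := by
  intro t
  have h2 := (mdifferentiableAt_mul_left' (E := E) a (γ t)).hasMFDerivAt.comp t (h t)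
  convert! h2 using 1
  apply iff_of_eq
  congr 1
  refine ContinuousLinearMap.ext fun r => ?_
  change r • mulInvariantVectorField X (a * γ t) = mfderiv 𝓘(ℝ, E) 𝓘(ℝ, E) (fun y : G => a * y) (γ t) (r • mulInvariantVectorField X (γ t))
  rw [mulInvariantVectorField_mul, map_smul]

end Calculus

/-! ### One-parameter subgroups and the exponential map. -/

section Exp

variable {E : Type*} [NormedAddCommGroup E] [NormedSpace ℝ E] [FiniteDimensional ℝ E]
  {G : Type*} [TopologicalSpace G] [T2Space G] [ChartedSpace E G] [Group G]
  [LieGroup 𝓘(ℝ, E) ∞ G]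

theorem IsExpCurve.lieExp_eq {X : GroupLieAlgebra 𝓘(ℝ, E) G} {γ : ℝ → G} (h : IsExpCurve X γ) :
    lieExp X = γ 1 := by
  have hex : ∃ γ : ℝ → G, IsExpCurve X γ := ⟨γ, h⟩
  rw [lieExp, dif_pos hex, hex.choose_spec.unique h]

theorem isExpCurve_lieExp (X : GroupLieAlgebra 𝓘(ℝ, E) G) :
    IsExpCurve X (fun t : ℝ => lieExp (G := G) (t • X)) := by
  obtain ⟨γ, h⟩ := exists_isExpCurve (G := G) X
  convert h using 2 with t
  rw [(h.smul t).lieExp_eq, one_mul]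

theorem lieExp_zero : lieExp (0 : GroupLieAlgebra 𝓘(ℝ, E) G) = 1 := by
  simpa using (isExpCurve_lieExp (0 : GroupLieAlgebra 𝓘(ℝ, E) G)).1

/-- The time-shifted one-parameter subgroup, translated back to start at 1, is again an integral
curve of the same field, so uniqueness applies. -/
theorem lieExp_add_smul (X : GroupLieAlgebra 𝓘(ℝ, E) G) (s t : ℝ) :
    lieExp ((s + t) • X) = lieExp (s • X) * lieExp (t • X) := by
  have h := isExpCurve_lieExp X
  have h' : IsExpCurve X (fun t : ℝ => (lieExp (s • X))⁻¹ * lieExp (G := G) ((t + s) • X)) :=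
    ⟨by simp, isMIntegralCurve_mul_left (h.2.comp_add s) _⟩
  rw [congrFun (h.unique h') t]
  simp [add_comm]

theorem lieExp_neg (X : GroupLieAlgebra 𝓘(ℝ, E) G) : lieExp (-X) = (lieExp X)⁻¹ := by
  have := lieExp_add_smul X (-1) 1
  rw [neg_add_cancel, zero_smul, lieExp_zero, one_smul, neg_smul, one_smul] at this
  exact eq_inv_of_mul_eq_one_left this.symm

theorem lieExp_natCast_smul (X : GroupLieAlgebra 𝓘(ℝ, E) G) (n : ℕ) :
    lieExp ((n : ℝ) • X) = lieExp X ^ n := by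
  induction n with
  | zero => simp [lieExp_zero]
  | succ n ih => rw [Nat.cast_succ, lieExp_add_smul, ih, one_smul, pow_succ]

theorem lieExp_intCast_smul (X : GroupLieAlgebra 𝓘(ℝ, E) G) (n : ℤ) :
    lieExp ((n : ℝ) • X) = lieExp X ^ n := by
  obtain ⟨n, rfl | rfl⟩ := n.eq_nat_or_neg
  · simpa using lieExp_natCast_smul X n
  · simp [lieExp_neg, lieExp_natCast_smul]

/-- The conjugated curve is shown to be the one-parameter subgroup of `Ad a X`, by differentiating
`(a x a⁻¹)(a y a⁻¹) = a (x y) a⁻¹` at `y = 1`. -/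
theorem lieExp_ad (a : G) (X : GroupLieAlgebra 𝓘(ℝ, E) G) :
    lieExp (Ad a X) = a * lieExp X * a⁻¹ := by
  have h := isExpCurve_lieExp X
  suffices h' : IsExpCurve (Ad a X) (fun t : ℝ => a * lieExp (G := G) (t • X) * a⁻¹) by
    simpa using h'.lieExp_eq
  refine ⟨by simp [lieExp_zero], fun t => ?_⟩
  have hr := mdifferentiableAt_mul_right' (E := E) (G := G) a⁻¹
  have hl := mdifferentiableAt_mul_left' (E := E) (G := G) a
  have hc : MDifferentiableAt 𝓘(ℝ, E) 𝓘(ℝ, E) (fun y : G => a * y * a⁻¹) (lieExp (t • X)) :=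
    (hr _).comp _ (hl _)
  have h2 := hc.hasMFDerivAt.comp t (h.2 t)
  convert! h2 using 1
  apply iff_of_eq
  congr 1
  set x := lieExp (t • X)
  refine ContinuousLinearMap.ext fun r => ?_
  change r • mulInvariantVectorField (Ad a X) (a * x * a⁻¹) =
    mfderiv 𝓘(ℝ, E) 𝓘(ℝ, E) (fun y : G => a * y * a⁻¹) x (r • mulInvariantVectorField X x)
  rw [map_smul]
  congr 1
  have key : ∀ z : G, z = x → ∀ u : E,
      (show E from mfderiv 𝓘(ℝ, E) 𝓘(ℝ, E) (fun y : G => a * y * a⁻¹) z u) =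
      (show E from mfderiv 𝓘(ℝ, E) 𝓘(ℝ, E) (fun y : G => a * y * a⁻¹) x u) := by
    rintro z rfl u; rfl
  have key2 : ∀ z : G, z = 1 → ∀ u : E,
      (show E from mfderiv 𝓘(ℝ, E) 𝓘(ℝ, E) (fun y : G => a * x * a⁻¹ * y) z u) =
      (show E from mfderiv 𝓘(ℝ, E) 𝓘(ℝ, E) (fun y : G => a * x * a⁻¹ * y) 1 u) := by
    rintro z rfl u; rfl
  have e1 := mfderiv_comp_apply (I := 𝓘(ℝ, E)) (I' := 𝓘(ℝ, E)) (I'' := 𝓘(ℝ, E)) (1 : G)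
    (g := fun y : G => a * y * a⁻¹) (f := fun y => x * y)
    ((hr _).comp _ (hl _)) (mdifferentiableAt_mul_left' x 1) X
  have e2 := mfderiv_comp_apply (I := 𝓘(ℝ, E)) (I' := 𝓘(ℝ, E)) (I'' := 𝓘(ℝ, E)) (1 : G)
    (g := fun y : G => a * x * a⁻¹ * y) (f := fun y => a * y * a⁻¹)
    (mdifferentiableAt_mul_left' _ _) ((hr _).comp _ (hl _)) X
  have D : (fun y : G => a * x * a⁻¹ * y) ∘ (fun y : G => a * y * a⁻¹) =
      (fun y : G => a * y * a⁻¹) ∘ (fun y => x * y) := by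
    ext y; simp [mul_assoc]
  rw [D] at e2
  exact ((key2 _ (by simp) _).symm.trans (e2.symm.trans e1)).trans (key _ (mul_one _) _)

end Exp

end LieGroupExp

end

/-! ### The invariant norm and uniform bounds on first and second derivatives. -/

noncomputable section

namespace LieGroupExp

open Set Filter Topology Bundle

namespace InvariantInner

variable {E : Type*} [NormedAddCommGroup E] [NormedSpace ℝ E]
  {G : Type*} [TopologicalSpace G] [ChartedSpace E G] [Group G] (B : InvariantInner E G)

theorem norm_nonneg (X : GroupLieAlgebra 𝓘(ℝ, E) G) : 0 ≤ B.norm X := Real.sqrt_nonneg _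

theorem norm_smul (c : ℝ) (X : GroupLieAlgebra 𝓘(ℝ, E) G) : B.norm (c • X) = |c| * B.norm X := by
  have : B.form (c • X) (c • X) = c ^ 2 * B.form X X := by
    simp only [map_smul, LinearMap.smul_apply, smul_eq_mul]; ring
  rw [norm, this, Real.sqrt_mul (sq_nonneg c), Real.sqrt_sq_eq_abs, norm]

theorem norm_neg (X : GroupLieAlgebra 𝓘(ℝ, E) G) : B.norm (-X) = B.norm X := by
  simpa using B.norm_smul (-1) X

theorem norm_ad (a : G) (X : GroupLieAlgebra 𝓘(ℝ, E) G) : B.norm (Ad a X) = B.norm X := by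
  rw [norm, B.ad_invariant, norm]

/-- The scalar product, as a bilinear form on the model space. -/
def modelForm : LinearMap.BilinForm ℝ E := B.form

variable [FiniteDimensional ℝ E]

theorem continuous_modelForm : Continuous (fun X : E => B.modelForm X X) := by
  have h : Continuous (fun p : E × E => B.modelForm p.1 p.2) :=
    B.modelForm.toContinuousBilinearMap.continuous₂
  exact h.comp (continuous_id.prodMk continuous_id)

/-- The norm of the scalar product, as a function on the model space. -/
def modelNorm (X : E) : ℝ := B.norm (show GroupLieAlgebra 𝓘(ℝ, E) G from X)

theorem continuous_modelNorm : Continuous B.modelNorm := B.continuous_modelForm.sqrt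

/-- Compactness of the unit sphere and homogeneity. In dimension zero the sphere is empty, hence the
separate case. -/
theorem exists_modelNorm_bounds :
    ∃ c C : ℝ, 0 < c ∧ 0 < C ∧ ∀ X : E, c * ‖X‖ ≤ B.modelNorm X ∧ B.modelNorm X ≤ C * ‖X‖ := by
  have hs : ∀ (r : ℝ) (X : E), B.modelNorm (r • X) = |r| * B.modelNorm X :=
    fun r X => B.norm_smul r X
  have h0 : B.modelNorm 0 = 0 := by simpa using hs 0 0
  have hpos : ∀ X : E, X ≠ 0 → 0 < B.modelNorm X := fun X hX => Real.sqrt_pos.2 (B.pos X hX)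
  rcases subsingleton_or_nontrivial E with hE | hE
  · refine ⟨1, 1, one_pos, one_pos, fun X => ?_⟩
    rw [Subsingleton.elim X 0, h0]; simp
  have hcpt := isCompact_sphere (0 : E) 1
  have hne : (Metric.sphere (0 : E) 1).Nonempty := NormedSpace.sphere_nonempty.2 zero_le_one
  obtain ⟨a, ha, hamin⟩ := hcpt.exists_isMinOn hne B.continuous_modelNorm.continuousOn
  obtain ⟨b, hb, hbmax⟩ := hcpt.exists_isMaxOn hne B.continuous_modelNorm.continuousOn
  have ne0 : ∀ x ∈ Metric.sphere (0 : E) 1, x ≠ 0 := fun x hx =>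
    Metric.ne_of_mem_sphere hx one_ne_zero
  refine ⟨B.modelNorm a, B.modelNorm b, hpos a (ne0 a ha), hpos b (ne0 b hb), fun X => ?_⟩
  rcases eq_or_ne X 0 with rfl | hX
  · simp [h0]
  have hn : 0 < ‖X‖ := norm_pos_iff.2 hX
  have hmem : ‖X‖⁻¹ • X ∈ Metric.sphere (0 : E) 1 := by
    simp [_root_.norm_smul, hn.ne']
  have key : B.modelNorm X = B.modelNorm (‖X‖⁻¹ • X) * ‖X‖ := by
    rw [hs, abs_of_pos (inv_pos.2 hn)]; field_simp
  rw [key]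
  exact ⟨mul_le_mul_of_nonneg_right (hamin hmem) hn.le, mul_le_mul_of_nonneg_right (hbmax hmem) hn.le⟩

end InvariantInner

section Bounds

variable {E : Type*} [NormedAddCommGroup E] [NormedSpace ℝ E] [FiniteDimensional ℝ E]
  {G : Type*} [TopologicalSpace G] [ChartedSpace E G] [Group G]
  (B : InvariantInner E G)

/-- A basis of the Lie algebra together with a bound on the coordinates. -/
theorem exists_basis_repr_le : ∃ (b : Module.Basis (Fin (Module.finrank ℝ E)) ℝ
    (GroupLieAlgebra 𝓘(ℝ, E) G)) (C : ℝ), 0 ≤ C ∧ ∀ i X, |b.repr X i| ≤ C * B.norm X := by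
  let b : Module.Basis (Fin (Module.finrank ℝ E)) ℝ E := Module.finBasis ℝ E
  obtain ⟨c, _, hc, _, hb⟩ := B.exists_modelNorm_bounds
  let φ : E →L[ℝ] (Fin (Module.finrank ℝ E) → ℝ) := LinearMap.toContinuousLinearMap b.equivFun
  refine ⟨b, ‖φ‖ * c⁻¹, by positivity, fun i X => ?_⟩
  change |φ X i| ≤ _
  calc |φ X i| ≤ ‖φ X‖ := norm_le_pi_norm (φ X) i
    _ ≤ ‖φ‖ * ‖(show E from X)‖ := φ.le_opNorm X
    _ ≤ ‖φ‖ * (c⁻¹ * B.norm X) := by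
        gcongr
        rw [inv_mul_eq_div, le_div_iff₀ hc, mul_comm]
        exact (hb X).1
    _ = _ := by ring

omit [FiniteDimensional ℝ E] in
theorem leftDeriv_eq_sum {ι : Type*} [Fintype ι]
    (b : Module.Basis ι ℝ (GroupLieAlgebra 𝓘(ℝ, E) G)) (f : G → ℝ)
    (X : GroupLieAlgebra 𝓘(ℝ, E) G) (x : G) :
    leftDeriv f X x = ∑ i, b.repr X i * leftDeriv f (b i) x := by
  have := congrArg (leftDerivₗ f x) (b.sum_repr X)
  rw [map_sum] at this
  simp only [map_smul, smul_eq_mul] at this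
  exact this.symm

variable [LieGroup 𝓘(ℝ, E) ∞ G] [CompactSpace G]

/-- Expanding `X` in a basis leaves finitely many continuous functions on a compact group, which
makes the bound uniform in `X`. -/
theorem exists_leftDeriv_le {f : G → ℝ} (hf : ContMDiff 𝓘(ℝ, E) 𝓘(ℝ, ℝ) 1 f) :
    ∃ C : ℝ, 0 ≤ C ∧ ∀ X x, |leftDeriv f X x| ≤ C * B.norm X := by
  obtain ⟨b, c, hc, hb⟩ := exists_basis_repr_le B
  have hbd : ∀ i, ∃ D, 0 ≤ D ∧ ∀ x, |leftDeriv f (b i) x| ≤ D := fun i => by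
    have hcont : Continuous (leftDeriv f (b i)) :=
      (contMDiff_leftDeriv (m := 0) hf (by simp) (by simp) (b i)).continuous
    obtain ⟨D, hD⟩ := isCompact_univ.exists_bound_of_continuousOn hcont.continuousOn
    exact ⟨|D|, abs_nonneg _, fun x => (hD x (mem_univ _)).trans (le_abs_self _)⟩
  choose D hD0 hD using hbd
  refine ⟨c * ∑ i, D i, mul_nonneg hc (Finset.sum_nonneg fun i _ => hD0 i), fun X x => ?_⟩
  rw [leftDeriv_eq_sum b]
  calc |∑ i, b.repr X i * leftDeriv f (b i) x|
      ≤ ∑ i, |b.repr X i * leftDeriv f (b i) x| := Finset.abs_sum_le_sum_abs _ _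
    _ ≤ ∑ i, (c * B.norm X) * D i := Finset.sum_le_sum fun i _ => by
        rw [abs_mul]
        exact mul_le_mul (hb i X) (hD i x) (abs_nonneg _) (mul_nonneg hc (B.norm_nonneg X))
    _ = _ := by rw [← Finset.mul_sum]; ring

theorem exists_leftDeriv_leftDeriv_le {f : G → ℝ} (hf : ContMDiff 𝓘(ℝ, E) 𝓘(ℝ, ℝ) 2 f) :
    ∃ C : ℝ, 0 ≤ C ∧ ∀ X Y x, |leftDeriv (leftDeriv f X) Y x| ≤ C * B.norm X * B.norm Y := by
  obtain ⟨b, c, hc, hb⟩ := exists_basis_repr_le B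
  have hsm : ∀ i, ContMDiff 𝓘(ℝ, E) 𝓘(ℝ, ℝ) 1 (leftDeriv f (b i)) := fun i =>
    contMDiff_leftDeriv hf (by norm_num) (by norm_num) (b i)
  choose D hD0 hD using fun i => exists_leftDeriv_le B (hsm i)
  refine ⟨c * ∑ i, D i, mul_nonneg hc (Finset.sum_nonneg fun i _ => hD0 i), fun X Y x => ?_⟩
  have hsum : leftDeriv f X = ∑ i, b.repr X i • leftDeriv f (b i) := by
    ext y
    rw [leftDeriv_eq_sum b]
    simp
  have hmd : ∀ i, HasMFDerivAt 𝓘(ℝ, E) 𝓘(ℝ, ℝ) (leftDeriv f (b i)) x _ := fun i =>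
    ((hsm i).mdifferentiableAt one_ne_zero).hasMFDerivAt
  have key : leftDeriv (leftDeriv f X) Y x =
      ∑ i, b.repr X i * leftDeriv (leftDeriv f (b i)) Y x := by
    have h := HasMFDerivAt.sum (t := Finset.univ) fun i _ => (hmd i).const_smul (b.repr X i)
    rw [← hsum] at h
    unfold leftDeriv at h ⊢
    rw [h.mfderiv]
    exact _root_.sum_apply (F := E →L[ℝ] ℝ) _ _ _
  rw [key]
  calc |∑ i, b.repr X i * leftDeriv (leftDeriv f (b i)) Y x|
      ≤ ∑ i, |b.repr X i * leftDeriv (leftDeriv f (b i)) Y x| := Finset.abs_sum_le_sum_abs _ _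
    _ ≤ ∑ i, (c * B.norm X) * (D i * B.norm Y) := Finset.sum_le_sum fun i _ => by
        rw [abs_mul]
        exact mul_le_mul (hb i X) (hD i Y x) (abs_nonneg _) (mul_nonneg hc (B.norm_nonneg X))
    _ = _ := by rw [← Finset.mul_sum, ← Finset.sum_mul]; ring

variable [T2Space G]

omit [CompactSpace G] in
/-- The mean value inequality along a one-parameter subgroup. -/
theorem abs_mul_lieExp_sub_le {f : G → ℝ} (hf : MDifferentiable 𝓘(ℝ, E) 𝓘(ℝ, ℝ) f)
    {X : GroupLieAlgebra 𝓘(ℝ, E) G} {C : ℝ} (hC : ∀ x, |leftDeriv f X x| ≤ C) (x : G) :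
    |f (x * lieExp X) - f x| ≤ C := by
  have hd := hasDerivAt_comp_isMIntegralCurve
    (isMIntegralCurve_mul_left (isExpCurve_lieExp (G := G) X).2 x) hf
  have := norm_image_sub_le_of_norm_deriv_le_segment_01'
    (fun t _ => (hd t).hasDerivWithinAt) (fun t _ => hC _)
  simpa [lieExp_zero] using this

/-- The mixed second difference of a `C²` function along two one-parameter subgroups. -/
theorem exists_abs_mixed_difference_le {f : G → ℝ} (hf : ContMDiff 𝓘(ℝ, E) 𝓘(ℝ, ℝ) 2 f) :
    ∃ C : ℝ, 0 ≤ C ∧ ∀ (x : G) X Y, |(f (x * lieExp X * lieExp Y) - f (x * lieExp X))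
      - (f (x * lieExp Y) - f x)| ≤ C * B.norm X * B.norm Y := by
  obtain ⟨C, hC0, hC⟩ := exists_leftDeriv_leftDeriv_le B hf
  refine ⟨C, hC0, fun x X Y => ?_⟩
  have hfd : MDifferentiable 𝓘(ℝ, E) 𝓘(ℝ, ℝ) f := hf.mdifferentiable two_ne_zero
  have hfd' : MDifferentiable 𝓘(ℝ, E) 𝓘(ℝ, ℝ) (leftDeriv f Y) :=
    (contMDiff_leftDeriv hf (m := 1) (by norm_num) (by norm_num) Y).mdifferentiable one_ne_zero
  have hd := fun y => hasDerivAt_comp_isMIntegralCurve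
    (isMIntegralCurve_mul_left (isExpCurve_lieExp (G := G) Y).2 y) hfd
  have := norm_image_sub_le_of_norm_deriv_le_segment_01' (C := C * B.norm X * B.norm Y)
    (fun t _ => ((hd (x * lieExp X) t).sub (hd x t)).hasDerivWithinAt) (fun t _ => by
      set e := lieExp (G := G) (t • Y)
      -- Moving `e` to the left of `exp X` turns the difference of the two derivatives into an
      -- increment of `leftDeriv f Y` along `Ad e⁻¹ X`, a vector of the same norm as `X`.
      have h1 : x * lieExp X * e = x * e * lieExp (Ad e⁻¹ X) := by
        rw [lieExp_ad]; group
      rw [h1, Real.norm_eq_abs]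
      refine abs_mul_lieExp_sub_le hfd' (fun y => (hC _ _ _).trans_eq ?_) _
      rw [B.norm_ad]; ring)
  simp only [one_smul, zero_smul, lieExp_zero, mul_one, Real.norm_eq_abs, Pi.sub_apply] at this
  convert this using 2
  ring

end Bounds

end LieGroupExp

end

/-! ### The Riemannian distance: local comparison with charts, finiteness and boundedness. -/

noncomputable section

namespace LieGroupExp

open Set Filter Topology Bundle Manifold
open scoped NNReal

namespace InvariantInner

section Metric

variable {E : Type*} [NormedAddCommGroup E] [NormedSpace ℝ E]
  {G : Type*} [TopologicalSpace G] [ChartedSpace E G] [Group G] (B : InvariantInner E G)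

theorem enormSMulClass_tangentENorm (x : G) :
    letI := B.tangentENorm x; ENormSMulClass ℝ (TangentSpace 𝓘(ℝ, E) x) :=
  letI := B.tangentENorm x
  ⟨fun r v => by
    change ENNReal.ofReal (B.norm (mfderiv 𝓘(ℝ, E) 𝓘(ℝ, E) (fun y : G => x⁻¹ * y) x (r • v))) =
      ‖r‖ₑ * ENNReal.ofReal (B.norm (mfderiv 𝓘(ℝ, E) 𝓘(ℝ, E) (fun y : G => x⁻¹ * y) x v))
    have h : ENNReal.ofReal (B.norm (mfderiv 𝓘(ℝ, E) 𝓘(ℝ, E) (fun y : G => x⁻¹ * y) x (r • v))) =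
        ENNReal.ofReal (|r| * (B.modelNorm
          (mfderiv 𝓘(ℝ, E) 𝓘(ℝ, E) (fun y : G => x⁻¹ * y) x v))) := by
      rw [map_smul]
      exact congrArg ENNReal.ofReal (B.norm_smul r _)
    rw [h, ENNReal.ofReal_mul (abs_nonneg r), Real.enorm_eq_ofReal_abs]
    rfl⟩

theorem edist_comm (x y : G) : B.edist x y = B.edist y x := by
  let : ∀ x : G, ENorm (TangentSpace 𝓘(ℝ, E) x) := B.tangentENorm
  have : ∀ x : G, ENormSMulClass ℝ (TangentSpace 𝓘(ℝ, E) x) := B.enormSMulClass_tangentENorm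
  exact riemannianEDist_comm

theorem edist_self (x : G) : B.edist x x = 0 := by
  let : ∀ x : G, ENorm (TangentSpace 𝓘(ℝ, E) x) := B.tangentENorm
  have : ∀ x : G, ENormSMulClass ℝ (TangentSpace 𝓘(ℝ, E) x) := B.enormSMulClass_tangentENorm
  exact riemannianEDist_self

theorem edist_triangle [IsManifold 𝓘(ℝ, E) 1 G] (x y z : G) :
    B.edist x z ≤ B.edist x y + B.edist y z := by
  let : ∀ x : G, ENorm (TangentSpace 𝓘(ℝ, E) x) := B.tangentENorm
  have : ∀ x : G, ENormSMulClass ℝ (TangentSpace 𝓘(ℝ, E) x) := B.enormSMulClass_tangentENorm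
  exact riemannianEDist_triangle

variable [FiniteDimensional ℝ E] [LieGroup 𝓘(ℝ, E) ∞ G]

/-- The derivative of an inverse chart is locally bounded for the left-invariant metric. -/
theorem exists_eventually_norm_mfderiv_symm_le (x : G) : ∃ C : ℝ≥0,
    ∀ᶠ z in 𝓝 (extChartAt 𝓘(ℝ, E) x x), ∀ v : E,
      ENNReal.ofReal (B.modelNorm (mfderiv 𝓘(ℝ, E) 𝓘(ℝ, E)
        (fun y : G => ((extChartAt 𝓘(ℝ, E) x).symm z)⁻¹ * y) ((extChartAt 𝓘(ℝ, E) x).symm z)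
        (mfderivWithin 𝓘(ℝ, E) 𝓘(ℝ, E) (extChartAt 𝓘(ℝ, E) x).symm (range 𝓘(ℝ, E)) z v)))
      ≤ C * ‖v‖ₑ := by
  have := isManifold_one E G
  obtain ⟨_, D, _, hD, hb⟩ := B.exists_modelNorm_bounds
  -- Read in fixed coordinates, the derivative of `w ↦ y⁻¹ * w` at `w = y` depends continuously on
  -- `y`, so its operator norm is bounded near `x`.
  have hsm : ContMDiffAt 𝓘(ℝ, E) 𝓘(ℝ, E →L[ℝ] E) 0
      (inTangentCoordinates 𝓘(ℝ, E) 𝓘(ℝ, E) (fun y : G => y) (fun y : G => y⁻¹ * y)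
        (fun y : G => mfderiv 𝓘(ℝ, E) 𝓘(ℝ, E) (fun w : G => y⁻¹ * w) y) x) x := by
    refine ContMDiffAt.mfderiv (n := 1) (fun y w : G => y⁻¹ * w) (fun y => y) ?_ contMDiffAt_id
      (by simp)
    have hi : ContMDiff (𝓘(ℝ, E).prod 𝓘(ℝ, E)) 𝓘(ℝ, E) ∞ (fun p : G × G => p.1⁻¹ * p.2) :=
      contMDiff_fst.inv.mul contMDiff_snd
    exact (hi.of_le (by exact_mod_cast le_top)).contMDiffAt
  have hsymm : Tendsto (extChartAt 𝓘(ℝ, E) x).symm (𝓝 (extChartAt 𝓘(ℝ, E) x x)) (𝓝 x) := by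
    simpa using (continuousAt_extChartAt_symm (I := 𝓘(ℝ, E)) x).tendsto
  set Φ := inTangentCoordinates 𝓘(ℝ, E) 𝓘(ℝ, E) (fun y : G => y) (fun y : G => y⁻¹ * y)
    (fun y : G => mfderiv 𝓘(ℝ, E) 𝓘(ℝ, E) (fun w : G => y⁻¹ * w) y) x
  have hbd : ∀ᶠ y in 𝓝 x, ‖Φ y‖ < ‖Φ x‖ + 1 :=
    hsm.continuousAt.norm.eventually_lt continuousAt_const (lt_add_one _)
  refine ⟨⟨D * (‖Φ x‖ + 1), by positivity⟩, ?_⟩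
  have htarget : (extChartAt 𝓘(ℝ, E) x).target ∈ 𝓝 (extChartAt 𝓘(ℝ, E) x x) :=
    extChartAt_target_mem_nhds x
  filter_upwards [hsymm hbd, hsymm (chart_source_mem_nhds E x), htarget] with z hz hz' hzt v
  -- The target point `y⁻¹ * y` is always 1, where the derivative of the chart centred there is the
  -- identity. The coordinate change in the target thus disappears.
  have hid : ∀ a b : G, a = b → ∀ w : E,
      (show E from mfderiv 𝓘(ℝ, E) 𝓘(ℝ, E) (extChartAt 𝓘(ℝ, E) a) b w) = w := by
    rintro a b rfl w
    rw [mfderiv_extChartAt_self]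
    rfl
  have hΦ := inTangentCoordinates_eq_mfderiv_comp (I := 𝓘(ℝ, E)) (I' := 𝓘(ℝ, E))
    (f := fun y : G => y) (g := fun y : G => y⁻¹ * y)
    (ϕ := fun y : G => mfderiv 𝓘(ℝ, E) 𝓘(ℝ, E) (fun w : G => y⁻¹ * w) y) (x₀ := x)
    (x := (extChartAt 𝓘(ℝ, E) x).symm z) hz' (by simp)
  have hΦv := (DFunLike.congr_fun hΦ v).trans (hid _ _ (by simp) _)
  rw [(extChartAt 𝓘(ℝ, E) x).right_inv hzt] at hΦv
  have hle : ‖Φ ((extChartAt 𝓘(ℝ, E) x).symm z) v‖ ≤ (‖Φ x‖ + 1) * ‖v‖ :=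
    (ContinuousLinearMap.le_opNorm _ v).trans (mul_le_mul_of_nonneg_right (le_of_lt hz)
      (_root_.norm_nonneg v))
  rw [ENNReal.ofReal_le_iff_le_toReal (by finiteness)]
  refine (le_of_eq ?_).trans (((hb _).2.trans (mul_le_mul_of_nonneg_left hle hD.le)).trans
    (le_of_eq ?_))
  · exact congrArg B.modelNorm hΦv.symm
  · rw [ENNReal.toReal_mul, toReal_enorm]
    exact (mul_assoc _ _ _).symm

/-- The Riemannian distance is locally controlled by the distance in a chart. -/
theorem exists_eventually_edist_le (x : G) : ∃ C : ℝ≥0, ∀ᶠ y in 𝓝 x,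
    B.edist x y ≤ C * EDist.edist (extChartAt 𝓘(ℝ, E) x x) (extChartAt 𝓘(ℝ, E) x y) := by
  have := isManifold_one E G
  let : ∀ x : G, ENorm (TangentSpace 𝓘(ℝ, E) x) := B.tangentENorm
  have : ∀ x : G, ENormSMulClass ℝ (TangentSpace 𝓘(ℝ, E) x) := B.enormSMulClass_tangentENorm
  obtain ⟨C, hC⟩ := B.exists_eventually_norm_mfderiv_symm_le x
  refine ⟨C, ?_⟩
  obtain ⟨r, r_pos, hr⟩ := Metric.mem_nhds_iff.1
    (inter_mem (extChartAt_target_mem_nhds (I := 𝓘(ℝ, E)) x) hC)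
  filter_upwards [(continuousAt_extChartAt (I := 𝓘(ℝ, E)) x).preimage_mem_nhds
    (Metric.ball_mem_nhds _ r_pos), chart_source_mem_nhds E x] with y hy h'y
  let η := ContinuousAffineMap.lineMap (R := ℝ) (extChartAt 𝓘(ℝ, E) x x) (extChartAt 𝓘(ℝ, E) x y)
  -- The competing path is the segment in the chart; its length is at most `C` times the Euclidean
  -- one.
  set γ := (extChartAt 𝓘(ℝ, E) x).symm ∘ η
  have hη : Icc 0 1 ⊆ ⇑η ⁻¹' Metric.ball (extChartAt 𝓘(ℝ, E) x x) r := by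
    simp only [← image_subset_iff, ContinuousAffineMap.coe_lineMap_eq,
      ← segment_eq_image_lineMap, η]
    exact (convex_ball _ _).segment_subset (by simp [r_pos]) hy
  have hη1 : Icc 0 1 ⊆ ⇑η ⁻¹' (extChartAt 𝓘(ℝ, E) x).target := fun t ht => (hr (hη ht)).1
  have η_smooth : ContMDiffOn 𝓘(ℝ, ℝ) 𝓘(ℝ, E) 1 η (Icc 0 1) := by
    apply ContMDiff.contMDiffOn
    rw [contMDiff_iff_contDiff]
    exact ContinuousAffineMap.contDiff _
  have hle : riemannianEDist 𝓘(ℝ, E) x y ≤ pathELength 𝓘(ℝ, E) γ 0 1 := by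
    apply riemannianEDist_le_pathELength _ _ _ zero_le_one
    · exact (contMDiffOn_extChartAt_symm x).comp η_smooth hη1
    · simp [γ, η, ContinuousAffineMap.coe_lineMap_eq]
    · simp [γ, η, ContinuousAffineMap.coe_lineMap_eq, h'y]
  refine hle.trans ?_
  rw [← lintegral_fderiv_lineMap_eq_edist, pathELength_eq_lintegral_mfderivWithin_Icc,
    ← lintegral_const_mul' _ _ ENNReal.coe_ne_top]
  apply setLIntegral_mono' measurableSet_Icc (fun t ht ↦ ?_)
  have hcomp : mfderivWithin 𝓘(ℝ, ℝ) 𝓘(ℝ, E) γ (Icc 0 1) t =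
      (mfderivWithin 𝓘(ℝ, E) 𝓘(ℝ, E) (extChartAt 𝓘(ℝ, E) x).symm (range 𝓘(ℝ, E)) (η t)) ∘L
        (mfderivWithin 𝓘(ℝ, ℝ) 𝓘(ℝ, E) η (Icc 0 1) t) := by
    apply mfderivWithin_comp
    · exact mdifferentiableWithinAt_extChartAt_symm (hη1 ht)
    · exact η_smooth.mdifferentiableOn one_ne_zero t ht
    · exact hη1.trans (preimage_mono (extChartAt_target_subset_range x))
    · rw [uniqueMDiffWithinAt_iff_uniqueDiffWithinAt]
      exact uniqueDiffOn_Icc zero_lt_one t ht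
  have hcomp1 := DFunLike.congr_fun hcomp (1 : ℝ)
  rw [mfderivWithin_eq_fderivWithin] at hcomp1
  exact (le_of_eq (congrArg (fun w : TangentSpace 𝓘(ℝ, E) (γ t) => ‖w‖ₑ) hcomp1)).trans
    ((hr (hη ht)).2 _)

theorem eventually_edist_lt (x : G) {r : ℝ≥0∞} (hr : 0 < r) : ∀ᶠ y in 𝓝 x, B.edist x y < r := by
  obtain ⟨C, hC⟩ := B.exists_eventually_edist_le x
  have ht : Tendsto (fun y => (C : ℝ≥0∞) * EDist.edist (extChartAt 𝓘(ℝ, E) x x)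
      (extChartAt 𝓘(ℝ, E) x y)) (𝓝 x) (𝓝 0) := by
    have h1 : Tendsto (fun y => EDist.edist (extChartAt 𝓘(ℝ, E) x x) (extChartAt 𝓘(ℝ, E) x y))
        (𝓝 x) (𝓝 0) := by
      have h2 := (tendsto_const_nhds (x := extChartAt 𝓘(ℝ, E) x x)).edist
        (continuousAt_extChartAt (I := 𝓘(ℝ, E)) x).tendsto
      rwa [PseudoEMetricSpace.edist_self] at h2
    simpa using ENNReal.Tendsto.const_mul h1 (Or.inr ENNReal.coe_ne_top)
  filter_upwards [hC, ht.eventually_lt_const hr] with y h1 h2 using h1.trans_lt h2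

theorem isOpen_setOf_edist_lt (x : G) (r : ℝ≥0∞) : IsOpen {y | B.edist y x < r} := by
  have := isManifold_one E G
  refine isOpen_iff_mem_nhds.2 fun y (hy : B.edist y x < r) => ?_
  filter_upwards [B.eventually_edist_lt y (tsub_pos_of_lt hy)] with z hz
  calc B.edist z x ≤ B.edist y z + B.edist y x := by
        rw [B.edist_comm y z]; exact B.edist_triangle z y x
    _ < r := by
        rw [add_comm]; exact lt_tsub_iff_left.1 hz

theorem isOpen_setOf_edist_eq_top (x : G) : IsOpen {y | B.edist y x = ⊤} := by
  have := isManifold_one E G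
  refine isOpen_iff_mem_nhds.2 fun y (hy : B.edist y x = ⊤) => ?_
  filter_upwards [B.eventually_edist_lt y ENNReal.zero_lt_top] with z hz
  have := B.edist_triangle y z x
  rw [hy, top_le_iff, ENNReal.add_eq_top] at this
  exact this.resolve_left hz.ne

/-- A path component for the Riemannian distance is bounded. -/
theorem exists_edist_le [CompactSpace G] (x : G) :
    ∃ D : ℝ≥0, ∀ y, B.edist y x ≠ ⊤ → B.edist y x ≤ D := by
  -- The points at finite distance form a closed, hence compact, set, covered by the increasing open
  -- balls of integer radius.
  have hcl : IsCompact {y | B.edist y x = ⊤}ᶜ :=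
    (B.isOpen_setOf_edist_eq_top x).isClosed_compl.isCompact
  obtain ⟨n, hn⟩ := hcl.elim_directed_cover (fun n : ℕ => {y | B.edist y x < n})
    (fun n => B.isOpen_setOf_edist_lt x n)
    (fun y hy => by
      obtain ⟨n, hn⟩ := ENNReal.exists_nat_gt (r := B.edist y x) hy
      exact mem_iUnion.2 ⟨n, hn⟩)
    (Monotone.directed_le (by
      intro m n hmn y hy
      exact lt_of_lt_of_le (b := (m : ℝ≥0∞)) hy (by exact_mod_cast hmn)))
  exact ⟨n, fun y hy => by simpa using (hn hy).le⟩

/-- The times at infinite distance from `γ t` form a clopen subset of the line that misses `t`. Only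
continuity of the curve is needed, not rectifiability. -/
theorem edist_ne_top_of_continuous {γ : ℝ → G} (hγ : Continuous γ) (s t : ℝ) :
    B.edist (γ s) (γ t) ≠ ⊤ := by
  have hclopen : IsClopen {r | B.edist (γ r) (γ t) = ⊤} := by
    refine ⟨⟨?_⟩, (B.isOpen_setOf_edist_eq_top (γ t)).preimage hγ⟩
    have := (B.isOpen_setOf_edist_lt (γ t) ⊤).preimage hγ
    convert this using 1
    ext r
    simp [lt_top_iff_ne_top]
  rcases isClopen_iff.1 hclopen with h | h
  · intro hs
    have : s ∈ {r | B.edist (γ r) (γ t) = ⊤} := hs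
    simp [h] at this
  · have : t ∈ {r | B.edist (γ r) (γ t) = ⊤} := h ▸ mem_univ t
    simp [B.edist_self] at this

end Metric

end InvariantInner

end LieGroupExp

end

noncomputable section

namespace LieGroupExp

open Set Filter Topology Bundle Manifold
open scoped NNReal

/-! ### A smooth substitute for the squared distance to 1. -/

section TestFunction

/-- Off the interior of `U`, a compact set, `φ` has a positive lower bound. Small sublevel sets thus
shrink to `x`. -/
theorem exists_pos_forall_lt_mem {M : Type*} [TopologicalSpace M] [CompactSpace M] {φ : M → ℝ}
    (hφ : Continuous φ) {x : M} (hpos : ∀ y, y ≠ x → 0 < φ y) {U : Set M} (hU : U ∈ 𝓝 x) :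
    ∃ δ : ℝ, 0 < δ ∧ ∀ y, φ y < δ → y ∈ U := by
  have hc : IsCompact (interior U)ᶜ := isOpen_interior.isClosed_compl.isCompact
  obtain ⟨δ, hδ, h⟩ := hc.exists_forall_le' hφ.continuousOn (a := 0)
    (fun y hy => hpos y fun h => hy (h ▸ mem_interior_iff_mem_nhds.2 hU))
  refine ⟨δ, hδ, fun y hy => ?_⟩
  by_contra hyU
  exact absurd (h y fun hi => hyU (interior_subset hi)) (not_le.2 hy)

variable {E : Type*} [NormedAddCommGroup E] [NormedSpace ℝ E] [FiniteDimensional ℝ E]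
  {G : Type*} [TopologicalSpace G] [T2Space G] [ChartedSpace E G] [Group G]
  [LieGroup 𝓘(ℝ, E) ∞ G]

/-- A smooth function vanishing at `1` only, which is the square of a Euclidean norm in a chart
around `1`. -/
theorem exists_contMDiff_eventually_eq_norm_sq :
    ∃ φ : G → ℝ, ContMDiff 𝓘(ℝ, E) 𝓘(ℝ, ℝ) ∞ φ ∧ φ 1 = 0 ∧ (∀ x, x ≠ 1 → 0 < φ x) ∧
      ∀ᶠ x in 𝓝 1, φ x =
        ‖toEuclidean (extChartAt 𝓘(ℝ, E) (1 : G) x - extChartAt 𝓘(ℝ, E) (1 : G) 1)‖ ^ 2 := by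
  obtain ⟨f, -⟩ := (SmoothBumpFunction.nhdsWithin_range_basis (I := 𝓘(ℝ, E)) (c := (1 : G))).ex_mem
  let q : E → ℝ := fun v => ‖toEuclidean (v - extChartAt 𝓘(ℝ, E) (1 : G) 1)‖ ^ 2
  have hq : ContDiff ℝ ∞ q :=
    (toEuclidean.contDiff.comp (contDiff_id.sub contDiff_const)).norm_sq ℝ
  have hh : ContMDiffOn 𝓘(ℝ, E) 𝓘(ℝ, ℝ) ∞ (fun x => q (extChartAt 𝓘(ℝ, E) (1 : G) x))
      (chartAt E (1 : G)).source :=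
    hq.contMDiff.comp_contMDiffOn contMDiffOn_extChartAt
  have hq0 : ∀ v, 0 ≤ q v := fun v => sq_nonneg _
  -- The bump `f` interpolates between the squared chart norm near 1 and the constant 1 far away.
  -- Where `f < 1` the second term is positive; where `f = 1` the point lies in the chart domain, so
  -- the first is positive unless `x = 1`.
  refine ⟨fun x => f x • q (extChartAt 𝓘(ℝ, E) (1 : G) x) + (1 - f x),
    (f.contMDiff_smul hh).add (contMDiff_const.sub f.contMDiff), ?_, fun x hx => ?_, ?_⟩
  · simp [q]
  · rcases f.le_one.lt_or_eq with h | h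
    · exact add_pos_of_nonneg_of_pos (mul_nonneg f.nonneg (hq0 _)) (sub_pos.2 h)
    · have hs : x ∈ (chartAt E (1 : G)).source :=
        f.support_subset_source (by rw [Function.mem_support, h]; exact one_ne_zero)
      have hne : extChartAt 𝓘(ℝ, E) (1 : G) x ≠ extChartAt 𝓘(ℝ, E) (1 : G) 1 := fun h' =>
        hx ((extChartAt 𝓘(ℝ, E) (1 : G)).injOn (by simpa using hs) (by simp) h')
      have : 0 < q (extChartAt 𝓘(ℝ, E) (1 : G) x) := by
        have h2 : toEuclidean (extChartAt 𝓘(ℝ, E) (1 : G) x - extChartAt 𝓘(ℝ, E) (1 : G) 1) ≠ 0 := by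
          rwa [Ne, map_eq_zero_iff _ toEuclidean.injective, sub_eq_zero]
        positivity
      simpa [h] using this
  · filter_upwards [f.eventuallyEq_one] with x hx
    simp [hx, q]

variable [CompactSpace G] (B : InvariantInner E G)

/-- A smooth function which controls the square of the Riemannian distance to `1`. -/
theorem exists_contMDiff_edist_le : ∃ (φ : G → ℝ) (C : ℝ), ContMDiff 𝓘(ℝ, E) 𝓘(ℝ, ℝ) ∞ φ ∧
    φ 1 = 0 ∧ (∀ x, x ≠ 1 → 0 < φ x) ∧ 0 ≤ C ∧
      ∀ x, B.edist x 1 ≠ ⊤ → B.edist x 1 ≤ ENNReal.ofReal (C * √(φ x)) := by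
  obtain ⟨φ, hφ, h1, hpos, hev⟩ := exists_contMDiff_eventually_eq_norm_sq (E := E) (G := G)
  obtain ⟨D, hD⟩ := B.exists_edist_le 1
  obtain ⟨A, hA⟩ := B.exists_eventually_edist_le 1
  obtain ⟨δ, hδ, hU⟩ := exists_pos_forall_lt_mem hφ.continuous hpos (hev.and hA)
  let e : E ≃L[ℝ] EuclideanSpace ℝ (Fin (Module.finrank ℝ E)) := toEuclidean
  let L : EuclideanSpace ℝ (Fin (Module.finrank ℝ E)) →L[ℝ] E := e.symm
  -- `A * ‖L‖` serves where `φ < δ`, through the chart comparison; `D / √δ` serves where `φ ≥ δ`,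
  -- through the bound `D` on finite distances.
  refine ⟨φ, A * ‖L‖ + D / √δ, hφ, h1, hpos, by positivity, fun x hx => ?_⟩
  rcases lt_or_ge (φ x) δ with h | h
  · obtain ⟨hx1, hx2⟩ := hU x h
    rw [B.edist_comm]
    refine hx2.trans ?_
    set v := extChartAt 𝓘(ℝ, E) (1 : G) x - extChartAt 𝓘(ℝ, E) (1 : G) 1
    have hv : ‖v‖ ≤ ‖L‖ * √(φ x) := by
      rw [hx1, Real.sqrt_sq (norm_nonneg _)]
      calc ‖v‖ = ‖L (e v)‖ := by simp [L]
        _ ≤ _ := L.le_opNorm _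
    rw [PseudoEMetricSpace.edist_comm, edist_eq_enorm_sub, ← ofReal_norm, ← ENNReal.ofReal_coe_nnreal,
      ← ENNReal.ofReal_mul A.coe_nonneg]
    refine ENNReal.ofReal_le_ofReal ?_
    calc (A : ℝ) * ‖v‖ ≤ A * (‖L‖ * √(φ x)) := by gcongr
      _ ≤ (A * ‖L‖ + D / √δ) * √(φ x) := by
        rw [add_mul, mul_assoc]
        exact le_add_of_nonneg_right (by positivity)
  · refine (hD x hx).trans ?_
    rw [← ENNReal.ofReal_coe_nnreal]
    refine ENNReal.ofReal_le_ofReal ?_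
    have h0 : 0 < √δ := Real.sqrt_pos.2 hδ
    calc (D : ℝ) = D / √δ * √δ := by field_simp
      _ ≤ D / √δ * √(φ x) := by gcongr
      _ ≤ _ := by
        rw [add_mul]
        exact le_add_of_nonneg_left (by positivity)

end TestFunction

/-! ### Continuity of the exponential map. -/

section ContinuousExp

variable {E : Type*} [NormedAddCommGroup E] [NormedSpace ℝ E] [FiniteDimensional ℝ E]
  {G : Type*} [TopologicalSpace G] [T2Space G] [ChartedSpace E G] [Group G]
  [LieGroup 𝓘(ℝ, E) ∞ G]

omit [FiniteDimensional ℝ E] [T2Space G] [LieGroup 𝓘(ℝ, E) ∞ G] in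
theorem ad_smul (a : G) (c : ℝ) (X : GroupLieAlgebra 𝓘(ℝ, E) G) : Ad a (c • X) = c • Ad a X := by
  unfold Ad
  exact map_smul (show E →L[ℝ] E from mfderiv 𝓘(ℝ, E) 𝓘(ℝ, E) (fun x : G => a * x * a⁻¹) 1) c X

theorem leftDeriv_mul_mul {f : G → ℝ} (hf : ContMDiff 𝓘(ℝ, E) 𝓘(ℝ, ℝ) 1 f) (a b : G)
    (X : GroupLieAlgebra 𝓘(ℝ, E) G) :
    leftDeriv (fun z => f (a * z * b)) X 1 = leftDeriv f (Ad b⁻¹ X) (a * b) := by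
  have hk : MDifferentiable 𝓘(ℝ, E) 𝓘(ℝ, ℝ) (fun z => f (a * z * b)) := fun z =>
    (hf.mdifferentiableAt one_ne_zero).comp z
      ((mdifferentiableAt_mul_right' b _).comp z (mdifferentiableAt_mul_left' a z))
  have h1 := hasDerivAt_comp_isMIntegralCurve (isExpCurve_lieExp (G := G) X).2 hk 0
  have h2 := hasDerivAt_comp_isMIntegralCurve (isMIntegralCurve_mul_left
    (isExpCurve_lieExp (G := G) (Ad b⁻¹ X)).2 (a * b)) (hf.mdifferentiable one_ne_zero) 0
  have he : (fun t : ℝ => f (a * lieExp (t • X) * b)) =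
      fun t => f (a * b * lieExp (t • Ad b⁻¹ X)) := by
    ext t
    rw [← ad_smul, lieExp_ad]
    congr 1
    group
  simp only [he, zero_smul, lieExp_zero, mul_one] at h1 h2
  exact h1.unique h2

theorem hasDerivAt_lieExp_mul_lieExp {f : G → ℝ} (hf : ContMDiff 𝓘(ℝ, E) 𝓘(ℝ, ℝ) 1 f)
    (X Y : GroupLieAlgebra 𝓘(ℝ, E) G) :
    HasDerivAt (fun t : ℝ => f (lieExp (t • X) * lieExp (t • Y))) (leftDeriv f (X + Y) 1) 0 := by
  have hF : MDifferentiable (𝓘(ℝ, E).prod 𝓘(ℝ, E)) 𝓘(ℝ, ℝ) (fun p : G × G => f (p.1 * p.2)) :=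
    ((hf.comp ((contMDiff_mul 𝓘(ℝ, E) ∞).of_le (by exact_mod_cast le_top))).mdifferentiable
      one_ne_zero)
  have hc := ((isExpCurve_lieExp (G := G) X).2 0).prodMk ((isExpCurve_lieExp (G := G) Y).2 0)
  have h2 := (hF _).hasMFDerivAt.comp 0 hc
  have h3 : HasFDerivAt (𝕜 := ℝ) (E := ℝ) (F := ℝ) _ _ (0 : ℝ) := hasMFDerivAt_iff_hasFDerivAt.1 h2
  refine h3.hasDerivAt.congr_deriv ?_
  change mfderiv (𝓘(ℝ, E).prod 𝓘(ℝ, E)) 𝓘(ℝ, ℝ) (fun p : G × G => f (p.1 * p.2))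
    (lieExp ((0 : ℝ) • X), lieExp ((0 : ℝ) • Y))
    ((1 : ℝ) • mulInvariantVectorField X _, (1 : ℝ) • mulInvariantVectorField Y _) = _
  rw [one_smul, one_smul]
  refine (mfderiv_prod_eq_add_apply (hF _)).trans ?_
  change leftDeriv (fun z => f (z * lieExp ((0 : ℝ) • Y))) X (lieExp ((0 : ℝ) • X)) +
    leftDeriv (fun z => f (lieExp ((0 : ℝ) • X) * z)) Y (lieExp ((0 : ℝ) • Y)) = _
  simp only [zero_smul, lieExp_zero, mul_one, one_mul]
  exact (leftDeriv_add f X Y 1).symm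

variable [CompactSpace G] (B : InvariantInner E G)

/-- Factoring `exp (sX) = a exp ((s-t)X)` and `exp (sY) = exp ((s-t)Y) b` shows that the derivative
at time `t` is along `Ad b⁻¹ (X + Y)`. The bound therefore involves `X + Y` alone and is small when
`Y` is close to `-X`. -/
theorem exists_abs_lieExp_mul_lieExp_sub_le {f : G → ℝ} (hf : ContMDiff 𝓘(ℝ, E) 𝓘(ℝ, ℝ) 1 f) :
    ∃ C : ℝ, ∀ X Y, |f (lieExp X * lieExp Y) - f 1| ≤ C * B.norm (X + Y) := by
  obtain ⟨C, hC0, hC⟩ := exists_leftDeriv_le B hf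
  refine ⟨C, fun X Y => ?_⟩
  have hd : ∀ t : ℝ, ∃ d, |d| ≤ C * B.norm (X + Y) ∧
      HasDerivAt (fun t : ℝ => f (lieExp (t • X) * lieExp (t • Y))) d t := fun t => by
    set a := lieExp (G := G) (t • X) with ha
    set b := lieExp (G := G) (t • Y) with hb
    have hk : ContMDiff 𝓘(ℝ, E) 𝓘(ℝ, ℝ) 1 (fun z => f (a * z * b)) :=
      hf.comp (((contMDiff_mul_left.mul contMDiff_const :
        ContMDiff 𝓘(ℝ, E) 𝓘(ℝ, E) ∞ (fun z : G => a * z * b))).of_le (by exact_mod_cast le_top))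
    refine ⟨leftDeriv f (Ad b⁻¹ (X + Y)) (a * b), ?_, ?_⟩
    · refine (hC _ _).trans_eq ?_
      rw [B.norm_ad]
    · rw [← leftDeriv_mul_mul hf]
      have h := hasDerivAt_lieExp_mul_lieExp hk X Y
      rw [← sub_self t] at h
      refine (h.comp_sub_const t t).congr_of_eventuallyEq (Eventually.of_forall fun s => ?_)
      have e1 : lieExp (G := G) (s • X) = a * lieExp ((s - t) • X) := by
        rw [ha, ← lieExp_add_smul]; congr 2; ring
      have e2 : lieExp (G := G) (s • Y) = lieExp ((s - t) • Y) * b := by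
        rw [hb, ← lieExp_add_smul]; congr 2; ring
      simp only [e1, e2, mul_assoc]
  choose d hd1 hd2 using hd
  have := norm_image_sub_le_of_norm_deriv_le_segment_01'
    (fun t _ => (hd2 t).hasDerivWithinAt) (fun t _ => hd1 t)
  simpa [lieExp_zero] using this

-- The previous estimate at the pair `(-Y, X)` gives `φ (exp(Y)⁻¹ exp X) ≤ C ‖X - Y‖`, and small
-- values of `φ` force closeness to 1. Continuity is what makes words measurable and keeps them at
-- finite distance from 1.
include B in
theorem continuous_lieExp : Continuous (lieExp : GroupLieAlgebra 𝓘(ℝ, E) G → G) := by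
  obtain ⟨φ, hφ, h1, hpos, -⟩ := exists_contMDiff_eventually_eq_norm_sq (E := E) (G := G)
  obtain ⟨C, hC⟩ := exists_abs_lieExp_mul_lieExp_sub_le B
    (hφ.of_le (m := 1) (by exact_mod_cast le_top))
  refine continuous_iff_continuousAt.2 fun Y => ?_
  have hn : Tendsto (fun X : E => C * B.modelNorm (-(show E from Y) + X)) (𝓝 (show E from Y))
      (𝓝 0) := by
    have hc : Continuous (fun X : E => C * B.modelNorm (-(show E from Y) + X)) :=
      continuous_const.mul (B.continuous_modelNorm.comp (continuous_const.add continuous_id))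
    have h0 : C * B.modelNorm (-(show E from Y) + (show E from Y)) = 0 := by
      rw [neg_add_cancel]
      have : B.modelNorm 0 = 0 := by
        have h := B.norm_smul 0 (0 : GroupLieAlgebra 𝓘(ℝ, E) G)
        rwa [zero_smul, abs_zero, zero_mul] at h
      rw [this, mul_zero]
    simpa only [h0] using hc.tendsto (show E from Y)
  have hlim : Tendsto (fun X : GroupLieAlgebra 𝓘(ℝ, E) G => lieExp (G := G) (-Y) * lieExp X)
      (𝓝 Y) (𝓝 1) := by
    refine tendsto_def.2 fun U hU => ?_
    obtain ⟨δ, hδ, hδU⟩ := exists_pos_forall_lt_mem hφ.continuous hpos hU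
    filter_upwards [hn.eventually_lt_const hδ] with X hX
    refine hδU _ (lt_of_le_of_lt ?_ hX)
    have := hC (-Y) X
    rw [h1, sub_zero] at this
    exact (le_abs_self _).trans this
  have := (contMDiff_mul_left' (E := E) (lieExp (G := G) Y)).continuous.tendsto 1 |>.comp hlim
  simpa [Function.comp_def, lieExp_neg, ContinuousAt] using this

end ContinuousExp

end LieGroupExp

end

/-! ### Words in a free group and the effect of flipping one letter. -/

noncomputable section

namespace FreeGroup

/-- The product of the syllables of a list, evaluated in a group. -/
def syllableProd {Q G : Type*} [Group G] (u : Q → G) (L : List (Q × ℤ)) : G :=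
  (L.map fun s => u s.1 ^ s.2).prod

theorem syllableProd_consSyllable {Q G : Type*} [DecidableEq Q] [Group G] (u : Q → G)
    (l : Q × Bool) (L : List (Q × ℤ)) :
    syllableProd u (consSyllable l L) = (cond l.2 (u l.1) (u l.1)⁻¹) * syllableProd u L := by
  obtain ⟨a, b⟩ := l
  cases L with
  | nil => cases b <;> simp [syllableProd, consSyllable]
  | cons s t =>
    by_cases h : s.1 = a
    · subst h
      cases b <;> simp [syllableProd, consSyllable, zpow_add, mul_assoc]
    · cases b <;> simp [syllableProd, consSyllable, h]

theorem lift_eq_syllableProd {Q G : Type*} [DecidableEq Q] [Group G] (u : Q → G)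
    (g : FreeGroup Q) : FreeGroup.lift u g = syllableProd u g.syllables := by
  have : ∀ L : List (Q × Bool), (L.map fun s => cond s.2 (u s.1) (u s.1)⁻¹).prod =
      syllableProd u (L.foldr consSyllable []) := fun L => by
    induction L with
    | nil => simp [syllableProd]
    | cons l L ih => rw [List.map_cons, List.prod_cons, ih, List.foldr_cons, syllableProd_consSyllable]
  rw [syllables, ← this, ← FreeGroup.lift_mk, FreeGroup.mk_toWord]

theorem S1_eq {Q : Type*} [DecidableEq Q] (x : Q) (g : FreeGroup Q) :
    S1 x g = ((g.syllables.filter fun s => s.1 = x).map fun s => |(s.2 : ℝ)|).sum := by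
  simp [S1, exponents, List.map_map, Function.comp_def]

theorem S1_nonneg {Q : Type*} [DecidableEq Q] (x : Q) (g : FreeGroup Q) : 0 ≤ S1 x g :=
  List.sum_nonneg fun _ h => by
    obtain ⟨n, -, rfl⟩ := List.mem_map.1 h
    exact abs_nonneg _

theorem continuous_lift {Q G : Type*} [Group G] [TopologicalSpace G] [IsTopologicalGroup G]
    (g : FreeGroup Q) : Continuous fun u : Q → G => FreeGroup.lift u g := by
  induction g using FreeGroup.induction_on with
  | C1 => simpa using continuous_const
  | of x => simpa using continuous_apply x
  | inv_of x _ =>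
    have h : Continuous fun u : Q → G => (u x)⁻¹ := (continuous_apply x).inv
    simpa using h
  | mul x y hx hy =>
    have h : Continuous fun u : Q → G => FreeGroup.lift u x * FreeGroup.lift u y := hx.mul hy
    simpa using h

theorem lift_projLE {P G : Type*} [LinearOrder P] [Group G] (x : P) (u : P → G)
    (g : FreeGroup P) : FreeGroup.lift (fun y : Set.Iic x => u y) (projLE x g) =
      FreeGroup.lift (fun y => if y ≤ x then u y else 1) g := by
  have : (FreeGroup.lift fun y : Set.Iic x => u y).comp (projLE x) =
      FreeGroup.lift (fun y => if y ≤ x then u y else 1) := by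
    ext y
    by_cases h : y ≤ x <;> simp [projLE, h]
  exact DFunLike.congr_fun this g

end FreeGroup

namespace LieGroupExp

open Set Filter Topology

section Words

variable {E : Type*} [NormedAddCommGroup E] [NormedSpace ℝ E] [FiniteDimensional ℝ E]
  {G : Type*} [TopologicalSpace G] [T2Space G] [ChartedSpace E G] [Group G]
  [LieGroup 𝓘(ℝ, E) ∞ G] (B : InvariantInner E G)

/-- Induction on syllables: if `p` is the tail with `x` erased, a leading `exp (nX)` crosses it as
`exp (Ad p⁻¹ (nX))`, at norm cost `|n| ‖X‖`. The same list `A` serves for `X` and `-X`, which is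
what permits the first-order cancellation. -/
theorem exists_syllableProd_update {Q : Type*} [DecidableEq Q] (L : List (Q × ℤ)) (x : Q)
    (u : Q → G) (X : GroupLieAlgebra 𝓘(ℝ, E) G) :
    ∃ A : List (GroupLieAlgebra 𝓘(ℝ, E) G),
      (A.map B.norm).sum = B.norm X * ((L.filter fun s => s.1 = x).map fun s => |(s.2 : ℝ)|).sum ∧
      FreeGroup.syllableProd (Function.update u x (lieExp X)) L =
        FreeGroup.syllableProd (Function.update u x 1) L * (A.map lieExp).prod ∧
      FreeGroup.syllableProd (Function.update u x (lieExp (-X))) L =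
        FreeGroup.syllableProd (Function.update u x 1) L * (A.map fun a => lieExp (-a)).prod := by
  induction L with
  | nil => exact ⟨[], by simp [FreeGroup.syllableProd]⟩
  | cons s t ih =>
    obtain ⟨A, h1, h2, h3⟩ := ih
    obtain ⟨y, n⟩ := s
    unfold FreeGroup.syllableProd at h2 h3 ⊢
    simp only [List.map_cons, List.prod_cons, h2, h3]
    by_cases h : y = x
    · subst h
      set p := (t.map fun s => Function.update u y 1 s.1 ^ s.2).prod
      refine ⟨Ad p⁻¹ ((n : ℝ) • X) :: A, ?_, ?_, ?_⟩
      · simp [B.norm_ad, B.norm_smul, h1]; ring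
      · simp [lieExp_ad, lieExp_intCast_smul, mul_assoc]
      · simp [lieExp_neg, lieExp_ad, lieExp_intCast_smul, mul_assoc]
    · refine ⟨A, ?_, ?_, ?_⟩
      · simp [h, h1]
      · simp [h, mul_assoc]
      · simp [h, mul_assoc]

variable {φ : G → ℝ} {C : ℝ}

section Lists

omit [FiniteDimensional ℝ E] [T2Space G] [LieGroup 𝓘(ℝ, E) ∞ G]

theorem sum_norm_nonneg (A : List (GroupLieAlgebra 𝓘(ℝ, E) G)) : 0 ≤ (A.map B.norm).sum :=
  List.sum_nonneg fun _ h => by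
    obtain ⟨a, -, rfl⟩ := List.mem_map.1 h
    exact B.norm_nonneg a

theorem sum_norm_sq_le (A : List (GroupLieAlgebra 𝓘(ℝ, E) G)) :
    (A.map fun a => B.norm a ^ 2).sum ≤ (A.map B.norm).sum ^ 2 := by
  induction A with
  | nil => simp
  | cons a t ih =>
    simp only [List.map_cons, List.sum_cons]
    nlinarith [mul_nonneg (B.norm_nonneg a) (sum_norm_nonneg B t)]

/-- Multiplying by one more factor shifts the base point of the later increments. Each shift is a
mixed second difference, so the error is at most a sum of `C ‖aᵢ‖ ‖aⱼ‖` over pairs `i < j`. -/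
theorem abs_prod_sub_sum_le (hC0 : 0 ≤ C)
    (hC : ∀ (x : G) X Y, |(φ (x * lieExp X * lieExp Y) - φ (x * lieExp X))
      - (φ (x * lieExp Y) - φ x)| ≤ C * B.norm X * B.norm Y)
    (A : List (GroupLieAlgebra 𝓘(ℝ, E) G)) (g : G) :
    |φ (g * (A.map lieExp).prod) - φ g - (A.map fun a => φ (g * lieExp a) - φ g).sum| ≤
      C * (A.map B.norm).sum ^ 2 := by
  induction A generalizing g with
  | nil => simp
  | cons a t ih =>
    have h2 : ∀ t : List (GroupLieAlgebra 𝓘(ℝ, E) G),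
        |(t.map fun b => φ (g * lieExp a * lieExp b) - φ (g * lieExp a)).sum -
          (t.map fun b => φ (g * lieExp b) - φ g).sum| ≤ C * B.norm a * (t.map B.norm).sum := by
      intro t
      induction t with
      | nil => simp
      | cons b t ih =>
        simp only [List.map_cons, List.sum_cons, mul_add]
        refine le_trans ?_ (add_le_add (hC g a b) ih)
        refine le_trans (le_of_eq ?_) (abs_add_le _ _)
        congr 1; ring
    have h1 := ih (g * lieExp a)
    have h2 := h2 t
    simp only [List.map_cons, List.sum_cons, List.prod_cons, ← mul_assoc]
    have h3 : 0 ≤ C * (B.norm a * (t.map B.norm).sum) :=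
      mul_nonneg hC0 (mul_nonneg (B.norm_nonneg a) (sum_norm_nonneg B t))
    have h4 : 0 ≤ C * B.norm a ^ 2 := by positivity
    rw [abs_le] at h1 h2 ⊢
    constructor <;> nlinarith

end Lists

/-- The constant 3 counts one error for linearising each of the two products, and one for the
symmetric second differences `φ (g exp a) + φ (g exp (-a)) - 2 φ g`. -/
theorem prod_add_prod_neg_le (hC0 : 0 ≤ C)
    (hC : ∀ (x : G) X Y, |(φ (x * lieExp X * lieExp Y) - φ (x * lieExp X))
      - (φ (x * lieExp Y) - φ x)| ≤ C * B.norm X * B.norm Y)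
    (A : List (GroupLieAlgebra 𝓘(ℝ, E) G)) (g : G) :
    φ (g * (A.map lieExp).prod) + φ (g * (A.map fun a => lieExp (-a)).prod) ≤
      2 * φ g + 3 * C * (A.map B.norm).sum ^ 2 := by
  have h1 := abs_prod_sub_sum_le B hC0 hC A g
  have h2 := abs_prod_sub_sum_le B hC0 hC (A.map fun a => -a) g
  simp only [List.map_map, Function.comp_def, B.norm_neg] at h2
  have h3 : ∀ A : List (GroupLieAlgebra 𝓘(ℝ, E) G),
      (A.map fun a => φ (g * lieExp a) - φ g).sum + (A.map fun a => φ (g * lieExp (-a)) - φ g).sum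
        ≤ C * (A.map fun a => B.norm a ^ 2).sum := by
    intro A
    induction A with
    | nil => simp
    | cons a t ih =>
      -- With `Y = -X` the mixed difference becomes the symmetric second difference, up to sign.
      have := hC g a (-a)
      rw [lieExp_neg, mul_inv_cancel_right, B.norm_neg, ← lieExp_neg] at this
      simp only [List.map_cons, List.sum_cons, mul_add]
      linarith [(abs_le.1 this).1, mul_assoc C (B.norm a) (B.norm a), sq (B.norm a),
        congrArg (C * ·) (sq (B.norm a))]
  have h4 := mul_le_mul_of_nonneg_left (sum_norm_sq_le B A) hC0
  have h5 := h3 A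
  have h1 := (abs_le.1 h1).2
  have h2 := (abs_le.1 h2).2
  linarith

/-- The second difference of a `C²` function of a word, when one letter is replaced by its
inverse, is at most quadratic in the number of occurrences of this letter. -/
theorem lift_update_add_lift_update_neg_le (hC0 : 0 ≤ C)
    (hC : ∀ (x : G) X Y, |(φ (x * lieExp X * lieExp Y) - φ (x * lieExp X))
      - (φ (x * lieExp Y) - φ x)| ≤ C * B.norm X * B.norm Y)
    {Q : Type*} [DecidableEq Q] (h : FreeGroup Q) (x : Q) (u : Q → G)
    (X : GroupLieAlgebra 𝓘(ℝ, E) G) :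
    φ (FreeGroup.lift (Function.update u x (lieExp X)) h) +
      φ (FreeGroup.lift (Function.update u x (lieExp (-X))) h) ≤
    2 * φ (FreeGroup.lift (Function.update u x 1) h) +
      3 * C * (B.norm X * FreeGroup.S1 x h) ^ 2 := by
  obtain ⟨A, h1, h2, h3⟩ := exists_syllableProd_update B h.syllables x u X
  simp only [FreeGroup.lift_eq_syllableProd, h2, h3, FreeGroup.S1_eq, ← h1]
  exact prod_add_prod_neg_le B hC0 hC A _

/-- Comparison of a word in the letters `≤ x` with the word in the letters `< x`. -/
theorem lift_le_add_lift_le_neg_le (hC0 : 0 ≤ C)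
    (hC : ∀ (x : G) X Y, |(φ (x * lieExp X * lieExp Y) - φ (x * lieExp X))
      - (φ (x * lieExp Y) - φ x)| ≤ C * B.norm X * B.norm Y)
    {P : Type*} [LinearOrder P] (g : FreeGroup P) (x : P)
    (H : P → GroupLieAlgebra 𝓘(ℝ, E) G) :
    φ (FreeGroup.lift (fun y => if y ≤ x then lieExp (H y) else 1) g) +
      φ (FreeGroup.lift (fun y => if y ≤ x then lieExp (Function.update H x (-H x) y) else 1) g) ≤
    2 * φ (FreeGroup.lift (fun y => if y < x then lieExp (H y) else 1) g) +
      3 * C * (B.norm (H x) *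
        FreeGroup.S1 (⟨x, le_rfl⟩ : Set.Iic x) (FreeGroup.projLE x g)) ^ 2 := by
  have key := lift_update_add_lift_update_neg_le B hC0 hC (FreeGroup.projLE x g)
    (⟨x, le_rfl⟩ : Set.Iic x) (fun y => lieExp (H y)) (H x)
  have e : ∀ (a : G) (v : P → G), v x = a → (∀ y, y < x → v y = lieExp (H y)) →
      FreeGroup.lift (Function.update (fun y : Set.Iic x => lieExp (G := G) (H y)) ⟨x, le_rfl⟩ a)
        (FreeGroup.projLE x g) = FreeGroup.lift (fun y => if y ≤ x then v y else 1) g :=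
      fun a v h1 h2 => by
    rw [← FreeGroup.lift_projLE]
    congr 2
    ext ⟨y, hy⟩
    rcases (show y ≤ x from hy).eq_or_lt with rfl | h
    · simp [h1]
    · rw [Function.update_of_ne (by simpa [Subtype.ext_iff] using h.ne), h2 y h]
  rw [e _ (fun y => lieExp (H y)) rfl fun _ _ => rfl,
    e _ (fun y => lieExp (Function.update H x (-H x) y)) (by simp)
      fun y h => by rw [Function.update_of_ne h.ne],
    e _ (fun y => if y < x then lieExp (H y) else 1) (by simp) fun y h => by simp [h]] at key
  refine key.trans_eq ?_
  congr 5
  ext y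
  by_cases h : y < x
  · simp [h, h.le]
  · simp [h]

end Words

end LieGroupExp

end

/-! ### Telescoping, symmetrisation and expectations. -/

noncomputable section

open Set Filter Topology

/-- Telescoping along the order. Indexing by sets lets `Iic` of one letter be the `Iio` of the next
without naming successors: when the maximum `m` is added to `t`, these sets are `Iic m` and `Iio m`.
-/
theorem sum_le_of_Iic_le_Iio_add {P : Type*} [LinearOrder P] [Fintype P] {a : Set P → ℝ} {c : P → ℝ}
    (h0 : a ∅ = 0) (h : ∀ x, a (Iic x) ≤ a (Iio x) + c x) : a univ ≤ ∑ x, c x := by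
  have key : ∀ s : Finset P, IsLowerSet (s : Set P) → a s ≤ ∑ x ∈ s, c x := fun s => by
    induction s using Finset.induction_on_max with
    | empty => intro _; simp [h0]
    | insert m t hm ih =>
      intro hl
      have h1 : ((insert m t : Finset P) : Set P) = Iic m := by
        ext y
        refine ⟨fun hy => ?_, fun hy => hl hy (Finset.mem_insert_self m t)⟩
        rcases Finset.mem_insert.1 hy with rfl | hy
        · exact le_rfl
        · exact (hm y hy).le
      have h2 : (t : Set P) = Iio m := by
        ext y
        refine ⟨fun hy => hm y hy, fun hy => ?_⟩
        have : y ∈ ((insert m t : Finset P) : Set P) := h1 ▸ (show y ≤ m from le_of_lt hy)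
        exact (Finset.mem_insert.1 this).resolve_left (ne_of_lt hy)
      have ih := ih (h2 ▸ isLowerSet_Iio m)
      rw [h2] at ih
      rw [h1, Finset.sum_insert fun hmt => lt_irrefl m (hm m hmt)]
      linarith [h m]
  simpa using key Finset.univ (by simpa using isLowerSet_univ)

/-- Nonnegativity of the variance of `√Z`. -/
theorem integral_sqrt_le_sqrt_integral {Ω : Type*} [MeasurableSpace Ω] {μ : Measure Ω}
    [IsProbabilityMeasure μ] {Z : Ω → ℝ} (hm : Measurable Z) (h0 : ∀ w, 0 ≤ Z w)
    {D : ℝ} (hD : ∀ w, Z w ≤ D) : ∫ w, √(Z w) ∂μ ≤ √(∫ w, Z w ∂μ) := by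
  have hL : MemLp (fun w => √(Z w)) 2 μ :=
    MemLp.of_bound hm.sqrt.aestronglyMeasurable (√D) (Eventually.of_forall fun w => by
      rw [Real.norm_of_nonneg (Real.sqrt_nonneg _)]
      exact Real.sqrt_le_sqrt (hD w))
  have h1 := variance_nonneg (fun w => √(Z w)) μ
  rw [variance_eq_sub hL] at h1
  refine Real.le_sqrt_of_sq_le ?_
  have h2 : μ[(fun w => √(Z w)) ^ 2] = ∫ w, Z w ∂μ :=
    integral_congr_ae (Eventually.of_forall fun w => Real.sq_sqrt (h0 w))
  linarith

/-- The joint law of independent random variables is not changed when one of them is replaced by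
its opposite, if this one is symmetric. -/
theorem identDistrib_update_neg {P Ω V : Type*} [DecidableEq P] [Fintype P] [MeasurableSpace Ω]
    {μ : Measure Ω} [IsProbabilityMeasure μ] [MeasurableSpace V] [Neg V] [MeasurableNeg V]
    {H : P → Ω → V} (hmeas : ∀ x, Measurable (H x)) (hindep : iIndepFun H μ) (x : P)
    (hsymm : IdentDistrib (fun w => -H x w) (H x) μ μ) :
    IdentDistrib (fun w => Function.update (fun y => H y w) x (-H x w)) (fun w y => H y w) μ μ := by
  let ε : P → V → V := fun y => if y = x then fun v => -v else id
  have hε : ∀ y, Measurable (ε y) := fun y => by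
    by_cases h : y = x
    · simp only [ε, h, if_true]; exact measurable_neg
    · simp only [ε, h, if_false]; exact measurable_id
  have hfun : (fun w => Function.update (fun y => H y w) x (-H x w)) =
      fun w y => (ε y ∘ H y) w := by
    ext w y
    by_cases h : y = x
    · subst h; simp [ε]
    · simp [ε, h]
  have h1 := (hindep.comp ε hε).map_fun_eq_pi_map fun y => ((hε y).comp (hmeas y)).aemeasurable
  have h2 := hindep.map_fun_eq_pi_map fun y => (hmeas y).aemeasurable
  have hm : ∀ y, μ.map (ε y ∘ H y) = μ.map (H y) := fun y => by
    by_cases h : y = x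
    · subst h
      simpa [ε, Function.comp_def] using hsymm.map_eq
    · simp [ε, h]
  rw [hfun]
  refine ⟨(measurable_pi_lambda _ fun y => (hε y).comp (hmeas y)).aemeasurable,
    (measurable_pi_lambda _ fun y => hmeas y).aemeasurable, ?_⟩
  rw [h1, h2]
  simp only [hm]

namespace LieGroupExp

variable {E : Type*} [NormedAddCommGroup E] [NormedSpace ℝ E] [FiniteDimensional ℝ E]
  {G : Type*} [TopologicalSpace G] [T2Space G] [CompactSpace G] [ChartedSpace E G] [Group G]
  [LieGroup 𝓘(ℝ, E) ∞ G]

section Words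

variable {P : Type*} (g : FreeGroup P)

/-- The word `g`, evaluated at the exponentials of a family of elements of the Lie algebra, after
erasing the letters which are not in `S`. -/
def wordExp (S : Set P) (H : P → GroupLieAlgebra 𝓘(ℝ, E) G) : G :=
  FreeGroup.lift (S.mulIndicator fun y => lieExp (H y)) g

omit [FiniteDimensional ℝ E] [T2Space G] [CompactSpace G] [LieGroup 𝓘(ℝ, E) ∞ G] in
theorem wordExp_univ (H : P → GroupLieAlgebra 𝓘(ℝ, E) G) :
    wordExp g univ H = FreeGroup.lift (fun y => lieExp (H y)) g := by
  simp [wordExp]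

omit [FiniteDimensional ℝ E] [T2Space G] [CompactSpace G] [LieGroup 𝓘(ℝ, E) ∞ G] in
theorem wordExp_empty (H : P → GroupLieAlgebra 𝓘(ℝ, E) G) : wordExp g ∅ H = 1 := by
  have : FreeGroup.lift (fun _ : P => (1 : G)) = 1 := by ext; simp
  rw [wordExp, mulIndicator_empty, this, MonoidHom.one_apply]

theorem continuous_wordExp (B : InvariantInner E G) (S : Set P) :
    Continuous (wordExp (E := E) (G := G) g S) := by
  have := topologicalGroup_of_lieGroup 𝓘(ℝ, E) ∞ (G := G)
  refine (FreeGroup.continuous_lift g).comp (continuous_pi fun y => ?_)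
  by_cases h : y ∈ S
  · simp only [h, mulIndicator_of_mem]
    exact (continuous_lieExp B).comp (continuous_apply y)
  · simp only [h, not_false_eq_true, mulIndicator_of_notMem]
    exact continuous_const

/-- Scaling all the `H y` by `t ∈ ℝ` gives a continuous curve through 1 at `t = 0` and through the
word at `t = 1`. -/
theorem edist_wordExp_ne_top (B : InvariantInner E G) (S : Set P)
    (H : P → GroupLieAlgebra 𝓘(ℝ, E) G) : B.edist (wordExp g S H) 1 ≠ ⊤ := by
  have hc : Continuous fun t : ℝ => wordExp g S (fun y => t • H y) :=
    (continuous_wordExp g B S).comp (continuous_pi fun y => by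
      exact (continuous_id.smul (continuous_const (y := (show E from H y))) :
        Continuous fun t : ℝ => t • (show E from H y)))
  have h0 : wordExp g S (fun y => (0 : ℝ) • H y) = 1 := by
    have : FreeGroup.lift (fun _ : P => (1 : G)) = 1 := by ext; simp
    simp only [wordExp, zero_smul, lieExp_zero, mulIndicator_one, this, MonoidHom.one_apply]
  have h := B.edist_ne_top_of_continuous hc 1 0
  simp only [one_smul, h0] at h
  exact h

omit [CompactSpace G] in
theorem wordExp_Iic_add_le [LinearOrder P] (B : InvariantInner E G) {φ : G → ℝ} {C : ℝ}
    (hC0 : 0 ≤ C)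
    (hC : ∀ (x : G) X Y, |(φ (x * lieExp X * lieExp Y) - φ (x * lieExp X))
      - (φ (x * lieExp Y) - φ x)| ≤ C * B.norm X * B.norm Y)
    (x : P) (H : P → GroupLieAlgebra 𝓘(ℝ, E) G) :
    φ (wordExp g (Iic x) H) + φ (wordExp g (Iic x) (Function.update H x (-H x))) ≤
    2 * φ (wordExp g (Iio x) H) + 3 * C * (B.norm (H x) *
        FreeGroup.S1 (⟨x, le_rfl⟩ : Set.Iic x) (FreeGroup.projLE x g)) ^ 2 := by
  have h1 : ∀ K : P → GroupLieAlgebra 𝓘(ℝ, E) G, wordExp g (Iic x) K =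
      FreeGroup.lift (fun y => if y ≤ x then lieExp (K y) else 1) g := fun K =>
    congrArg (fun u : P → G => FreeGroup.lift u g) (funext fun y => by simp [mulIndicator])
  have h2 : wordExp g (Iio x) H = FreeGroup.lift (fun y => if y < x then lieExp (H y) else 1) g :=
    congrArg (fun u : P → G => FreeGroup.lift u g) (funext fun y => by simp [mulIndicator])
  rw [h1, h1, h2]
  exact lift_le_add_lift_le_neg_le B hC0 hC g x H

end Words

section Expectation

variable [MeasurableSpace (GroupLieAlgebra 𝓘(ℝ, E) G)] [BorelSpace (GroupLieAlgebra 𝓘(ℝ, E) G)]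
  (B : InvariantInner E G) {P : Type*} [Fintype P] (g : FreeGroup P)

include B in
theorem measurable_preimage_wordExp (S : Set P) {U : Set G} (hU : IsOpen U) :
    MeasurableSet (wordExp (E := E) g S ⁻¹' U) := by
  have := FiniteDimensional.proper ℝ E
  -- Second countability makes the product σ-algebra on `P → 𝔤` the Borel one, so open sets pull
  -- back to measurable sets; no σ-algebra on `G` is involved.
  have : SecondCountableTopology (GroupLieAlgebra 𝓘(ℝ, E) G) :=
    inferInstanceAs (SecondCountableTopology E)
  exact (hU.preimage (continuous_wordExp g B S)).measurableSet

include B in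
theorem measurable_comp_wordExp (S : Set P) {f : G → ℝ} (hf : Continuous f) :
    Measurable fun H => f (wordExp (E := E) g S H) := by
  refine measurable_of_Iio fun r => ?_
  exact measurable_preimage_wordExp B g S (isOpen_Iio.preimage hf)

theorem measurable_edist_wordExp (S : Set P) :
    Measurable fun H => B.edist (wordExp (E := E) g S H) 1 := by
  refine measurable_of_Iio fun r => ?_
  exact measurable_preimage_wordExp B g S (B.isOpen_setOf_edist_lt 1 r)

variable {Ω : Type*} [MeasurableSpace Ω] {μ : Measure Ω} [IsProbabilityMeasure μ]
  {H : P → Ω → GroupLieAlgebra 𝓘(ℝ, E) G}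

/-- Integrating the two-sign inequality, both terms on its left have the same expectation, so each
letter costs at most `(3/2) C r² S1²`. The final constant is rounded up to 2. -/
theorem integral_wordExp_le [LinearOrder P] {φ : G → ℝ} (hφ : Continuous φ) (h1 : φ 1 = 0) {C : ℝ}
    (hC0 : 0 ≤ C)
    (hC : ∀ (x : G) X Y, |(φ (x * lieExp X * lieExp Y) - φ (x * lieExp X))
      - (φ (x * lieExp Y) - φ x)| ≤ C * B.norm X * B.norm Y)
    (hmeas : ∀ x, Measurable (H x)) (hindep : iIndepFun H μ)
    (hsymm : ∀ x, IdentDistrib (fun w => -H x w) (H x) μ μ) {r : ℝ}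
    (hsupp : ∀ x, ∀ᵐ w ∂μ, B.norm (H x w) ≤ r) :
    ∫ w, φ (FreeGroup.lift (fun x => lieExp (H x w)) g) ∂μ ≤ 2 * C * r ^ 2 * g.norm2 ^ 2 := by
  set S : P → ℝ := fun x => FreeGroup.S1 (⟨x, le_rfl⟩ : Set.Iic x) (FreeGroup.projLE x g)
  have hHm : Measurable fun w y => H y w := measurable_pi_lambda _ hmeas
  obtain ⟨D, hD⟩ := isCompact_univ.exists_bound_of_continuousOn hφ.continuousOn
  have hD : ∀ x, ‖φ x‖ ≤ D := fun x => hD x (mem_univ x)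
  have hstep : ∀ x, ∫ w, φ (wordExp g (Iic x) fun y => H y w) ∂μ ≤
      ∫ w, φ (wordExp g (Iio x) fun y => H y w) ∂μ + 3 / 2 * C * r ^ 2 * S x ^ 2 := fun x => by
    have hid := identDistrib_update_neg hmeas hindep x (hsymm x)
    have hcomp := hid.comp (measurable_comp_wordExp B g (Iic x) hφ)
    have hint : ∀ T, Integrable (fun w => φ (wordExp g T fun y => H y w)) μ := fun T =>
      Integrable.of_bound ((measurable_comp_wordExp B g T hφ).comp hHm).aestronglyMeasurable D
        (Eventually.of_forall fun w => hD _)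
    have hint' := hcomp.integrable_iff.2 (hint (Iic x))
    have heq := hcomp.integral_eq
    simp only [Function.comp_def] at heq hint'
    have hle : ∫ w, (φ (wordExp g (Iic x) fun y => H y w) +
        φ (wordExp g (Iic x) (Function.update (fun y => H y w) x (-H x w)))) ∂μ ≤
        ∫ w, (2 * φ (wordExp g (Iio x) fun y => H y w) + 3 * C * (r * S x) ^ 2) ∂μ := by
      refine integral_mono_ae ((hint _).add hint')
        (((hint _).const_mul 2).add (integrable_const _)) ?_
      filter_upwards [hsupp x] with w hw
      refine (wordExp_Iic_add_le g B hC0 hC x fun y => H y w).trans ?_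
      have hS0 : 0 ≤ S x := FreeGroup.S1_nonneg _ _
      have h0 := B.norm_nonneg (H x w)
      gcongr
    rw [integral_add (hint _) hint', integral_add ((hint _).const_mul 2) (integrable_const _),
      integral_const_mul, integral_const, heq] at hle
    simp only [probReal_univ, one_smul] at hle
    linarith [mul_pow r (S x) 2, congrArg (3 * C * ·) (mul_pow r (S x) 2)]
  have hsum := sum_le_of_Iic_le_Iio_add
    (a := fun T => ∫ w, φ (wordExp g T fun y => H y w) ∂μ) (by simp [wordExp_empty, h1]) hstep
  simp only [wordExp_univ] at hsum
  have hn : g.norm2 ^ 2 = ∑ x, S x ^ 2 := Real.sq_sqrt (Finset.sum_nonneg fun x _ => sq_nonneg _)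
  rw [← Finset.mul_sum, ← hn] at hsum
  refine hsum.trans ?_
  have : 0 ≤ C * r ^ 2 * g.norm2 ^ 2 := by positivity
  linarith

end Expectation

end LieGroupExp

end

/-! ### The proposition. -/

open LieGroupExp Set in
theorem mainTheorem6
    {E : Type*} [NormedAddCommGroup E] [NormedSpace ℝ E] [FiniteDimensional ℝ E]
    {G : Type*} [TopologicalSpace G] [T2Space G] [CompactSpace G] [ChartedSpace E G] [Group G]
    [LieGroup 𝓘(ℝ, E) ∞ G]
    [MeasurableSpace (GroupLieAlgebra 𝓘(ℝ, E) G)] [BorelSpace (GroupLieAlgebra 𝓘(ℝ, E) G)]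
    (B : LieGroupExp.InvariantInner E G) :
    ∃ C c : ℝ, 0 < C ∧ 0 < c ∧
      ∀ (P : Type*) [LinearOrder P] [Fintype P] (_hP : 4 ≤ Fintype.card P)
        (K : ℝ) (_hK : 1 ≤ K)
        (Ω : Type*) [MeasurableSpace Ω] (μ : Measure Ω) [IsProbabilityMeasure μ]
        (H : P → Ω → GroupLieAlgebra 𝓘(ℝ, E) G)
        (_hmeas : ∀ x, Measurable (H x))
        (_hindep : iIndepFun H μ)
        (_hident : ∀ x y, IdentDistrib (H x) (H y) μ μ)
        (_hAd : ∀ (x : P) (a : G), IdentDistrib (fun w => LieGroupExp.Ad a (H x w)) (H x) μ μ)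
        (_hsymm : ∀ x, IdentDistrib (fun w => -H x w) (H x) μ μ)
        (_hsupp : ∀ x, ∀ᵐ w ∂μ, B.norm (H x w) ≤ K⁻¹)
        (g : FreeGroup P) (_hg : g.norm2 ^ 2 ≤ c * K ^ 2),
        Measurable (fun w => B.edist (FreeGroup.lift (fun x => LieGroupExp.lieExp (H x w)) g) 1) ∧
        ∫⁻ w, B.edist (FreeGroup.lift (fun x => LieGroupExp.lieExp (H x w)) g) 1 ∂μ ≤
          ENNReal.ofReal (C * (K⁻¹ * g.norm2 +
            Real.log (Fintype.card P) ^ 2 / Real.log (Real.log (Fintype.card P)) *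
              (K ^ 2)⁻¹ * g.norm2 ^ 2)) := by
  obtain ⟨φ, A, hφ, h1, hpos, hA0, hA⟩ := exists_contMDiff_edist_le B
  have hφ0 : ∀ x, 0 ≤ φ x := fun x => by
    rcases eq_or_ne x 1 with rfl | h
    · exact h1.ge
    · exact (hpos x h).le
  obtain ⟨C, hC0, hC⟩ := exists_abs_mixed_difference_le B
    (hφ.of_le (m := 2) (WithTop.coe_le_coe.2 le_top))
  -- `A * √(2 * C)` comes from the comparison with `φ` followed by Jensen; adding 1 ensures
  -- positivity.
  refine ⟨A * √(2 * C) + 1, 1, by positivity, one_pos, ?_⟩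
  intro P _ _ hP K hK Ω _ μ _ H hmeas hindep _ _ hsymm hsupp g _
  have hHm : Measurable fun w y => H y w := measurable_pi_lambda _ hmeas
  constructor
  · simpa only [Function.comp_def, wordExp_univ] using (measurable_edist_wordExp B g univ).comp hHm
  obtain ⟨D, hD⟩ := isCompact_univ.exists_bound_of_continuousOn hφ.continuous.continuousOn
  have hD : ∀ x, φ x ≤ D := fun x => (le_abs_self _).trans (hD x (mem_univ x))
  set Z : Ω → ℝ := fun w => φ (FreeGroup.lift (fun x => lieExp (H x w)) g)
  have hZm : Measurable Z := by
    simpa only [Function.comp_def, wordExp_univ] using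
      (measurable_comp_wordExp B g univ hφ.continuous).comp hHm
  have hint : ∫ w, Z w ∂μ ≤ 2 * C * K⁻¹ ^ 2 * g.norm2 ^ 2 :=
    integral_wordExp_le B g hφ.continuous h1 hC0 hC hmeas hindep hsymm hsupp
  have hn0 : 0 ≤ g.norm2 := Real.sqrt_nonneg _
  have hK0 : 0 ≤ K⁻¹ := inv_nonneg.2 (zero_le_one.trans hK)
  have hsqrt : ∫ w, √(Z w) ∂μ ≤ √(2 * C) * (K⁻¹ * g.norm2) := by
    refine (integral_sqrt_le_sqrt_integral hZm (fun w => hφ0 _) (fun w => hD _)).trans ?_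
    refine (Real.sqrt_le_sqrt hint).trans_eq ?_
    rw [show 2 * C * K⁻¹ ^ 2 * g.norm2 ^ 2 = 2 * C * (K⁻¹ * g.norm2) ^ 2 by ring,
      Real.sqrt_mul (by positivity), Real.sqrt_sq (by positivity)]
  have hZint : Integrable (fun w => √(Z w)) μ :=
    Integrable.of_bound hZm.sqrt.aestronglyMeasurable (√D) (Filter.Eventually.of_forall fun w => by
      rw [Real.norm_of_nonneg (Real.sqrt_nonneg _)]
      exact Real.sqrt_le_sqrt (hD _))
  have hlog : 0 ≤ Real.log (Fintype.card P) ^ 2 / Real.log (Real.log (Fintype.card P)) *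
      (K ^ 2)⁻¹ * g.norm2 ^ 2 := by
    have h4 : (4 : ℝ) ≤ Fintype.card P := by exact_mod_cast hP
    -- Since `4 > e`, the iterated logarithm is nonnegative, and so is the logarithmic term.
    have hl : 1 ≤ Real.log (Fintype.card P) := by
      rw [Real.le_log_iff_exp_le (by linarith)]
      linarith [Real.exp_one_lt_d9]
    have := Real.log_nonneg hl
    positivity
  calc ∫⁻ w, B.edist (FreeGroup.lift (fun x => lieExp (H x w)) g) 1 ∂μ
      ≤ ∫⁻ w, ENNReal.ofReal (A * √(Z w)) ∂μ := by
        refine lintegral_mono fun w => hA _ ?_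
        rw [← wordExp_univ]
        exact edist_wordExp_ne_top g B univ _
    _ = ENNReal.ofReal (A * ∫ w, √(Z w) ∂μ) := by
        rw [← integral_const_mul, ofReal_integral_eq_lintegral_ofReal (hZint.const_mul A)
          (Filter.Eventually.of_forall fun w => mul_nonneg hA0 (Real.sqrt_nonneg _))]
    _ ≤ _ := by
        refine ENNReal.ofReal_le_ofReal ?_
        have h2 := mul_le_mul_of_nonneg_left hsqrt hA0
        have h3 : 0 ≤ K⁻¹ * g.norm2 := mul_nonneg hK0 hn0
        have h4 : 0 ≤ A * √(2 * C) := by positivity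
        have h5 := mul_nonneg h4 hlog
        nlinarith
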